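/- Let $d\in\{2,3\}$, let $\Omega\subset\mathbb R^d$ be bounded and open, let $\mu_r,\tau_y:\Omega\to(0,\infty)$ be measurable (reference viscosity and yield stress) with $\tau_y\in L^2(\Omega)$, let $f\in L^2(\Omega)^d$, and let $\underline\mu\ge 0$ be a constant. Let $V$ be the set of all $u\in H^1_0(\Omega)^d$ with $\nabla\cdot u=0$, where $H^1_0(\Omega)^d$ is the closure of $C_c^\infty(\Omega)^d$ in the $H^1$ norm. Put $\dot\varepsilon(u)=\frac12(\nabla u+\nabla u^{T})$ and $\dot\varepsilon_{II}(u)=\big(\frac12\dot\varepsilon(u):\dot\varepsilon(u)\big)^{1/2}$. The ideal and the composite viscosity are $$\mu_i(u)=\underline\mu+\min\Big(\frac{\tau_y}{2\dot\varepsilon_{II}(u)},\mu_r\Big),\qquad \mu_c(u)=\frac{\tau_y\mu_r}{2\dot\varepsilon_{II}(u)\mu_r+\tau_y},$$ where the minimum is $\mu_r$ if $\dot\varepsilon_{II}(u)=0$. For $\sigma\ge0$ let $$\varphi_i(\sigma)=\begin{cases}2\mu_r\sigma^2+\dfrac{\tau_y^2}{2\mu_r}&\text{if }2\mu_r\sigma\le\tau_y,\\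 2\tau_y\sigma&\text{otherwise,}\end{cases}\qquad \varphi_c(\sigma)=2\tau_y\sigma-\frac{\tau_y^2}{\mu_r}\log(\tau_y+2\mu_r\sigma),$$ and, for $u\in V$, $$\Phi(u)=\int_\Omega\varphi(\dot\varepsilon_{II}(u))\,dx+2\underline\mu\int_\Omega\dot\varepsilon_{II}(u)^2\,dx-\int_\Omega f\cdot u\,dx,$$ with $\varphi=\varphi_i$, $\underline\mu\ge0$ for the ideal law, and $\varphi=\varphi_c$, $\underline\mu=0$ for the composite law. For $\mu=\mu_i$ or $\mu=\mu_c$, a velocity solution of the viscoplastic Stokes problem with homogeneous Dirichlet boundary conditions is a $u\in V$ with $\int_\Omega 2\mu(u)\,\dot\varepsilon(u):\dot\varepsilon(v)\,dx=\int_\Omega f\cdot v\,dx$ for all $v\in V$. A velocity-pressure solution is a pair $(u,p)\in V\times L^2(\Omega)$ with $\int_\Omega 2\mu(u)\,\dot\varepsilon(u):\dot\varepsilon(v)\,dx-\int_\Omega p\,\nabla\cdot v\,dx=\int_\Omega f\cdot v\,dx$ for all $v\in H_0^1(\Omega)^d$; then $u$ is a velocity solution. 1. (Ideal law.) If $\varphi_i(0)\in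 L^1(\Omega)$, then for every $\underline\mu\ge0$ all integrals in $\Phi(u)$, $u\in V$, converge and $\Phi$ is convex on $V$; if $\underline\mu>0$, then $\Phi$ is strictly convex on $V$. If $\underline\mu>0$, then (whether or not $\varphi_i(0)\in L^1(\Omega)$) there is exactly one velocity solution, and any two velocity-pressure solutions have the same velocity. 2. (Composite law.) If $\varphi_c(0)\in L^1(\Omega)$, then all integrals in $\Phi(u)$, $u\in V$, converge and $\Phi$ is convex, and even strictly convex, on $V$. In any case there is at most one velocity solution, and any two velocity-pressure solutions have the same velocity. 3. (Ideal law with $\underline\mu=0$.) Uniqueness may fail: for each $d\in\{2,3\}$ there are a bounded, open, connected, nonempty $\Omega\subset\mathbb R^d$, constants $\mu_r,\tau_y>0$ and $f\in L^2(\Omega)^d$ for which there are two velocity-pressure solutions with different velocities; in particular there are two different velocity solutions. (The conditions $\tau_y\in L^2(\Omega)$, $\varphi_i(0)\in L^1(\Omega)$ and $\varphi_c(0)\in L^1(\Omega)$ all hold if $\mu_r$ and $\tau_y$ are bounded above and bounded away from $0$.) -/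

import Mathlib

open MeasureTheory Filter Topology
open scoped ContDiff

noncomputable section

namespace Viscoplastic

/-- Points of `ℝᵈ`, and values of velocity fields. -/
abbrev Vec (d : ℕ) : Type := EuclideanSpace ℝ (Fin d)

/-- Second-order tensors. -/
abbrev Tensor (d : ℕ) : Type := Matrix (Fin d) (Fin d) ℝ

/-- `L²(Ω)ᵈ`; its elements are velocity fields up to equality almost everywhere in `Ω`. -/
abbrev L2 {d : ℕ} (Ω : Set (Vec d)) : Type := Lp (Vec d) 2 (volume.restrict Ω)

/-! ### The Sobolev space of velocities -/

/-- Infinitely differentiable functions with compact support contained in `Ω`. -/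
def IsTest {d : ℕ} {F : Type*} [NormedAddCommGroup F] [NormedSpace ℝ F]
    (Ω : Set (Vec d)) (ψ : Vec d → F) : Prop :=
  ContDiff ℝ ∞ ψ ∧ HasCompactSupport ψ ∧ tsupport ψ ⊆ Ω

/-- Classical partial derivative in the `j`-th coordinate direction. -/
def partialDeriv {d : ℕ} {F : Type*} [NormedAddCommGroup F] [NormedSpace ℝ F]
    (j : Fin d) (ψ : Vec d → F) (x : Vec d) : F :=
  fderiv ℝ ψ x (EuclideanSpace.single j (1 : ℝ))

/-- `G` is a square-integrable weak gradient of `u` in `Ω`: the entry `G i j` is the weak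
derivative `∂ⱼ uᵢ`. -/
def IsWeakGradient {d : ℕ} (Ω : Set (Vec d)) (u : Vec d → Vec d) (G : Vec d → Tensor d) : Prop :=
  (∀ i j : Fin d, MemLp (fun x => G x i j) 2 (volume.restrict Ω)) ∧
  ∀ ψ : Vec d → ℝ, IsTest Ω ψ → ∀ i j : Fin d,
    ∫ x in Ω, u x i * partialDeriv j ψ x = - ∫ x in Ω, G x i j * ψ x

open Classical in
/-- The weak gradient `∇u`. For open `Ω` it is determined almost everywhere in `Ω` as soon as it
exists; the value `0` is used where it does not exist. -/
def weakGradient {d : ℕ} (Ω : Set (Vec d)) (u : Vec d → Vec d) : Vec d → Tensor d :=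
  if h : ∃ G, IsWeakGradient Ω u G then h.choose else 0

/-- `H₀¹(Ω)ᵈ`: the fields in `L²(Ω)ᵈ` with square-integrable weak gradient that are limits, in the
`H¹` norm, of smooth fields with compact support in `Ω`. -/
def H10 {d : ℕ} (Ω : Set (Vec d)) : Set (L2 Ω) :=
  {u | ∃ G : Vec d → Tensor d, IsWeakGradient Ω u G ∧
    ∃ w : ℕ → Vec d → Vec d, (∀ n, IsTest Ω (w n)) ∧
      Tendsto (fun n => eLpNorm (fun x => u x - w n x) 2 (volume.restrict Ω)) atTop (𝓝 0) ∧
      ∀ i j : Fin d, Tendsto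
        (fun n => eLpNorm (fun x => G x i j - partialDeriv j (w n) x i) 2 (volume.restrict Ω))
        atTop (𝓝 0)}

/-- Weak divergence: the trace of the weak gradient. -/
def divergence {d : ℕ} (Ω : Set (Vec d)) (u : Vec d → Vec d) (x : Vec d) : ℝ :=
  (weakGradient Ω u x).trace

/-- The divergence-free fields in `H₀¹(Ω)ᵈ`. -/
def Admissible {d : ℕ} (Ω : Set (Vec d)) : Set (L2 Ω) :=
  {u | u ∈ H10 Ω ∧ ∀ᵐ x ∂(volume.restrict Ω), divergence Ω u x = 0}

/-! ### Strain rate and rheologies -/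

/-- The inner product `A : B` of second-order tensors. -/
def contract {d : ℕ} (A B : Tensor d) : ℝ := ∑ i, ∑ j, A i j * B i j

/-- The strain rate tensor `ε(u) = (∇u + ∇uᵀ) / 2`. -/
def strainRate {d : ℕ} (Ω : Set (Vec d)) (u : Vec d → Vec d) (x : Vec d) : Tensor d :=
  (1 / 2 : ℝ) • (weakGradient Ω u x + (weakGradient Ω u x).transpose)

/-- The second invariant `(ε(u) : ε(u) / 2) ^ (1 / 2)` of the strain rate tensor. -/
def secondInv {d : ℕ} (Ω : Set (Vec d)) (u : Vec d → Vec d) (x : Vec d) : ℝ :=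
  Real.sqrt (1 / 2 * contract (strainRate Ω u x) (strainRate Ω u x))

/-- Effective viscosity of the ideal law, with lower bound `μlow`, reference viscosity `μr` and
yield stress `τy`, at second invariant `s`. At `s = 0` the quotient `τy / (2 s)` is `+∞`, so that
the minimum is `μr`. -/
def viscIdeal (μlow μr τy s : ℝ) : ℝ :=
  μlow + if s = 0 then μr else min (τy / (2 * s)) μr

/-- Effective viscosity of the composite law. -/
def viscComposite (μr τy s : ℝ) : ℝ := τy * μr / (2 * s * μr + τy)

/-- Energy density of the ideal law (without its lower viscosity bound). -/
def phiIdeal (μr τy s : ℝ) : ℝ :=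
  if 2 * μr * s ≤ τy then 2 * μr * s ^ 2 + τy ^ 2 / (2 * μr) else 2 * τy * s

/-- Energy density of the composite law. -/
def phiComposite (μr τy s : ℝ) : ℝ :=
  2 * τy * s - τy ^ 2 / μr * Real.log (τy + 2 * μr * s)

/-! ### Energy and weak solutions -/

/-- The energy
`Φ(u) = ∫ φ(x, II(u)) dx + 2 μlow ∫ II(u)² dx - ∫ f · u dx` over `Ω`, where `φ` may depend on the
point `x` through the reference viscosity and the yield stress. -/
def energy {d : ℕ} (Ω : Set (Vec d)) (φ : Vec d → ℝ → ℝ) (μlow : ℝ) (f : Vec d → Vec d)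
    (u : L2 Ω) : ℝ :=
  (∫ x in Ω, φ x (secondInv Ω u x)) + 2 * μlow * (∫ x in Ω, secondInv Ω u x ^ 2)
    - ∫ x in Ω, inner ℝ (f x) (u x)

/-- The three integrals in `energy` converge. -/
def EnergyFinite {d : ℕ} (Ω : Set (Vec d)) (φ : Vec d → ℝ → ℝ) (f : Vec d → Vec d)
    (u : L2 Ω) : Prop :=
  IntegrableOn (fun x => φ x (secondInv Ω u x)) Ω ∧
  IntegrableOn (fun x => secondInv Ω u x ^ 2) Ω ∧
  IntegrableOn (fun x => inner ℝ (f x) (u x)) Ω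

/-- The integrand `2 μ(u) ε(u) : ε(v) = μ(u) (∇u + ∇uᵀ) : ∇v` of the viscous term, for a viscosity
law `μ x s` at the point `x` and second invariant `s`. -/
def viscousIntegrand {d : ℕ} (Ω : Set (Vec d)) (μ : Vec d → ℝ → ℝ) (u v : Vec d → Vec d)
    (x : Vec d) : ℝ :=
  2 * μ x (secondInv Ω u x) * contract (strainRate Ω u x) (strainRate Ω v x)

/-- `u` is a (weak) velocity solution of the Stokes problem with viscosity law `μ`, force `f` and
homogeneous Dirichlet conditions: `u` is divergence-free and the momentum equation holds when
tested with divergence-free fields (so that the pressure drops out). -/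
def IsVelocitySolution {d : ℕ} (Ω : Set (Vec d)) (μ : Vec d → ℝ → ℝ) (f : Vec d → Vec d)
    (u : L2 Ω) : Prop :=
  u ∈ Admissible Ω ∧ ∀ v ∈ Admissible Ω,
    IntegrableOn (viscousIntegrand Ω μ u v) Ω ∧
    ∫ x in Ω, viscousIntegrand Ω μ u v x = ∫ x in Ω, inner ℝ (f x) (v x)

/-- `(u, p)` is a weak velocity-pressure solution of the Stokes problem: `u` is divergence-free,
`p` is square-integrable, and the momentum equation holds when tested with all of `H₀¹(Ω)ᵈ`. -/
def IsStokesSolution {d : ℕ} (Ω : Set (Vec d)) (μ : Vec d → ℝ → ℝ) (f : Vec d → Vec d)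
    (u : L2 Ω) (p : Vec d → ℝ) : Prop :=
  u ∈ Admissible Ω ∧ MemLp p 2 (volume.restrict Ω) ∧ ∀ v ∈ H10 Ω,
    IntegrableOn (viscousIntegrand Ω μ u v) Ω ∧
    (∫ x in Ω, viscousIntegrand Ω μ u v x) - (∫ x in Ω, p x * divergence Ω v x)
      = ∫ x in Ω, inner ℝ (f x) (v x)

end Viscoplastic

end

/-!
The ideal and the composite energy densities `φ` are convex functions of the second invariant `s`,
with subgradient `4 μ(s) s`. By the Cauchy-Schwarz inequality the stress `2 μ ε` is then a
subgradient of the density `φ(II(ε))` at the tensor `ε`, which makes the energy convex and the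
stress monotone, strictly so for the composite law and for a positive lower viscosity bound. By
the inequalities of Korn and Poincaré the strain rate determines the velocity, whence strict
convexity of the energy and uniqueness of solutions.

For a positive lower viscosity bound the energy is even strongly convex, and the minimizer exists
by completeness. The density `φ(s) - φ(0)` is bounded by `2 τ s` and has the same critical points,
so that `φ(0)` need not be integrable.

Without a lower bound, the ideal stress depends in the plastic range only on the direction of the
strain rate. Two vortices rotating around an axis, constant on nested tori up to rotation, with
shear rates that differ only where both are plastic, therefore have the same stress. It is smooth
with compact support, and its negative divergence is a force for which both vortices are
solutions with zero pressure.
-/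

noncomputable section

namespace Viscoplastic

/-! ### Algebra of second-order tensors -/

section Tensors

variable {d : ℕ}

/-- The symmetric part of a tensor. -/
def symPart : Tensor d →ₗ[ℝ] Tensor d :=
  (1 / 2 : ℝ) • (LinearMap.id + (Matrix.transposeLinearEquiv (Fin d) (Fin d) ℝ ℝ).toLinearMap)

/-- The second invariant `(A : A / 2) ^ (1 / 2)` of a tensor. -/
def tensorInv (A : Tensor d) : ℝ := Real.sqrt (1 / 2 * contract A A)

lemma symPart_apply (A : Tensor d) (i j : Fin d) : symPart A i j = 1 / 2 * (A i j + A j i) := by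
  simp [symPart, mul_add]

lemma strainRate_eq_symPart (Ω : Set (Vec d)) (u : Vec d → Vec d) (x : Vec d) :
    strainRate Ω u x = symPart (weakGradient Ω u x) := rfl

lemma contract_comm (A B : Tensor d) : contract A B = contract B A := by
  simp only [contract, mul_comm]

lemma contract_add_right (A B C : Tensor d) :
    contract A (B + C) = contract A B + contract A C := by
  simp only [contract, Matrix.add_apply, mul_add, Finset.sum_add_distrib]

lemma contract_sub_right (A B C : Tensor d) :
    contract A (B - C) = contract A B - contract A C := by
  simp only [contract, Matrix.sub_apply, mul_sub, Finset.sum_sub_distrib]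

lemma contract_smul_right (c : ℝ) (A B : Tensor d) : contract A (c • B) = c * contract A B := by
  simp only [contract, Matrix.smul_apply, smul_eq_mul, Finset.mul_sum, mul_left_comm]

lemma contract_add_left (A B C : Tensor d) :
    contract (A + B) C = contract A C + contract B C := by
  simp only [contract_comm _ C, contract_add_right]

lemma contract_sub_left (A B C : Tensor d) :
    contract (A - B) C = contract A C - contract B C := by
  simp only [contract_comm _ C, contract_sub_right]

lemma contract_smul_left (c : ℝ) (A B : Tensor d) : contract (c • A) B = c * contract A B := by
  simp only [contract_comm _ B, contract_smul_right]

lemma contract_symPart_right (A B : Tensor d) :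
    contract A (symPart B) = contract (symPart A) B := by
  have transposed : ∑ i, ∑ j, A i j * B j i = ∑ i, ∑ j, A j i * B i j := Finset.sum_comm
  simp only [contract, symPart_apply, mul_add, add_mul, mul_left_comm (A _ _), mul_assoc,
    Finset.sum_add_distrib, ← Finset.mul_sum, transposed]

lemma contract_self_nonneg (A : Tensor d) : 0 ≤ contract A A :=
  Finset.sum_nonneg fun _ _ => Finset.sum_nonneg fun _ _ => mul_self_nonneg _

lemma sq_entry_le_contract_self (A : Tensor d) (i j : Fin d) : A i j ^ 2 ≤ contract A A := by
  rw [sq]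
  calc A i j * A i j ≤ ∑ j, A i j * A i j :=
        Finset.single_le_sum (f := fun j => A i j * A i j) (fun _ _ => mul_self_nonneg _)
          (Finset.mem_univ j)
    _ ≤ contract A A :=
        Finset.single_le_sum (f := fun i => ∑ j, A i j * A i j)
          (fun _ _ => Finset.sum_nonneg fun _ _ => mul_self_nonneg _) (Finset.mem_univ i)

lemma contract_self_pos {A : Tensor d} (hA : A ≠ 0) : 0 < contract A A := by
  refine (contract_self_nonneg A).lt_of_ne' fun hzero => hA ?_
  ext i j
  exact pow_eq_zero_iff two_ne_zero |>.1
    (le_antisymm (hzero ▸ sq_entry_le_contract_self A i j) (sq_nonneg _))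

lemma tensorInv_nonneg (A : Tensor d) : 0 ≤ tensorInv A := Real.sqrt_nonneg _

lemma contract_self_eq (A : Tensor d) : contract A A = 2 * tensorInv A ^ 2 := by
  have := contract_self_nonneg A
  rw [tensorInv, Real.sq_sqrt (by positivity)]
  ring

lemma abs_entry_le (A : Tensor d) (i j : Fin d) : |A i j| ≤ 2 * tensorInv A := by
  apply abs_le_of_sq_le_sq _ (by have := tensorInv_nonneg A; positivity)
  have := sq_entry_le_contract_self A i j
  rw [contract_self_eq] at this
  nlinarith [sq_nonneg (tensorInv A)]

lemma abs_contract_le (A B : Tensor d) : |contract A B| ≤ 2 * tensorInv A * tensorInv B := by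
  have hA := tensorInv_nonneg A
  have hB := tensorInv_nonneg B
  apply abs_le_of_sq_le_sq _ (by positivity)
  have cauchySchwarz : contract A B ^ 2 ≤ contract A A * contract B B := by
    simpa only [contract, Fintype.sum_prod_type, pow_two (A _ _), pow_two (B _ _)] using
      Finset.sum_mul_sq_le_sq_mul_sq (Finset.univ : Finset (Fin d × Fin d))
        (fun p => A p.1 p.2) (fun p => B p.1 p.2)
  rw [contract_self_eq, contract_self_eq] at cauchySchwarz
  linarith

lemma tensorInv_smul (c : ℝ) (A : Tensor d) : tensorInv (c • A) = |c| * tensorInv A := by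
  rw [tensorInv, contract_smul_left, contract_smul_right, ← Real.sqrt_sq_eq_abs, tensorInv,
    ← Real.sqrt_mul (sq_nonneg c)]
  ring_nf

lemma continuous_contract : Continuous fun p : Tensor d × Tensor d => contract p.1 p.2 := by
  unfold contract
  fun_prop

lemma continuous_tensorInv : Continuous (tensorInv (d := d)) :=
  Real.continuous_sqrt.comp (continuous_const.mul
    (continuous_contract.comp (continuous_id.prodMk continuous_id)))

end Tensors

/-! ### Potentials of viscosity laws -/

section Potentials

/-- The energy density `φ` is a potential of the viscosity law `μ ≥ 0`: on `[0, ∞)`, the slope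
`4 μ(s) s` is a subgradient of `φ` at `s`. -/
structure IsPotential (φ μ : ℝ → ℝ) : Prop where
  nonneg : ∀ ⦃s⦄, 0 ≤ s → 0 ≤ μ s
  le : ∀ ⦃s t⦄, 0 ≤ s → 0 ≤ t → φ s + 4 * μ s * s * (t - s) ≤ φ t

/-- The energy density `φ` is a strictly convex potential of the viscosity law `μ > 0`. -/
structure IsStrictPotential (φ μ : ℝ → ℝ) : Prop where
  pos : ∀ ⦃s⦄, 0 ≤ s → 0 < μ s
  lt : ∀ ⦃s t⦄, 0 ≤ s → 0 ≤ t → s ≠ t → φ s + 4 * μ s * s * (t - s) < φ t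

variable {φ μ : ℝ → ℝ}

lemma IsStrictPotential.isPotential (h : IsStrictPotential φ μ) : IsPotential φ μ where
  nonneg _ hs := (h.pos hs).le
  le s t hs ht := by
    rcases eq_or_ne s t with rfl | hst
    · simp
    · exact (h.lt hs ht hst).le

lemma IsPotential.le_of_nonneg (h : IsPotential φ μ) {s : ℝ} (hs : 0 ≤ s) : φ 0 ≤ φ s := by
  simpa using h.le le_rfl hs

lemma IsPotential.le_add_of_le (h : IsPotential φ μ) {s τ : ℝ} (hs : 0 ≤ s)
    (hτ : 2 * μ s * s ≤ τ) : φ s ≤ φ 0 + 2 * τ * s := by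
  nlinarith [h.le hs le_rfl]

lemma IsPotential.add_sq (h : IsPotential φ μ) {m : ℝ} (hm : 0 ≤ m) :
    IsPotential (fun s => φ s + 2 * m * s ^ 2) (fun s => m + μ s) where
  nonneg _ hs := add_nonneg hm (h.nonneg hs)
  le s t hs ht := by nlinarith [h.le hs ht, mul_nonneg hm (sq_nonneg (t - s))]

lemma IsPotential.isStrictPotential_add_sq (h : IsPotential φ μ) {m : ℝ} (hm : 0 < m) :
    IsStrictPotential (fun s => φ s + 2 * m * s ^ 2) (fun s => m + μ s) where
  pos _ hs := add_pos_of_pos_of_nonneg hm (h.nonneg hs)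
  lt s t hs ht hst := by
    nlinarith [h.le hs ht, mul_pos hm (sq_pos_of_ne_zero (sub_ne_zero.2 hst.symm))]

/-- The stress tensor `2 μ(II(A)) A` of the viscosity law `μ` at the strain rate `A`. -/
def stress {d : ℕ} (μ : ℝ → ℝ) (A : Tensor d) : Tensor d := (2 * μ (tensorInv A)) • A

variable {d : ℕ}

lemma viscousIntegrand_eq_contract_stress (Ω : Set (Vec d)) (μ : Vec d → ℝ → ℝ)
    (u v : Vec d → Vec d) (x : Vec d) :
    viscousIntegrand Ω μ u v x
      = contract (stress (μ x) (strainRate Ω u x)) (strainRate Ω v x) := by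
  rw [stress, contract_smul_left]
  rfl

lemma IsPotential.stress_subgradient (h : IsPotential φ μ) (A B : Tensor d) :
    φ (tensorInv A) + contract (stress μ A) (B - A) ≤ φ (tensorInv B) := by
  have hA := tensorInv_nonneg A
  have cauchySchwarz := mul_le_mul_of_nonneg_left (le_of_abs_le (abs_contract_le A B))
    (h.nonneg hA)
  rw [stress, contract_smul_left, contract_sub_right, contract_self_eq]
  linarith [h.le hA (tensorInv_nonneg B)]

lemma contract_lt_of_tensorInv_eq {A B : Tensor d} (hAB : A ≠ B)
    (hinv : tensorInv A = tensorInv B) : contract A B < 2 * tensorInv A ^ 2 := by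
  have hpos := contract_self_pos (sub_ne_zero.2 hAB)
  rw [contract_sub_left, contract_sub_right, contract_sub_right, contract_comm B A,
    contract_self_eq, contract_self_eq, ← hinv] at hpos
  linarith

lemma IsStrictPotential.stress_subgradient (h : IsStrictPotential φ μ) {A B : Tensor d}
    (hAB : A ≠ B) :
    φ (tensorInv A) + contract (stress μ A) (B - A) < φ (tensorInv B) := by
  have hA := tensorInv_nonneg A
  rw [stress, contract_smul_left, contract_sub_right, contract_self_eq]
  by_cases hinv : tensorInv A = tensorInv B
  · have := mul_lt_mul_of_pos_left (contract_lt_of_tensorInv_eq hAB hinv) (h.pos hA)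
    rw [← hinv]
    linarith
  · have cauchySchwarz := mul_le_mul_of_nonneg_left (le_of_abs_le (abs_contract_le A B))
      (h.pos hA).le
    linarith [h.lt hA (tensorInv_nonneg B) hinv]

lemma IsStrictPotential.stress_strictMono (h : IsStrictPotential φ μ) {A B : Tensor d}
    (hAB : A ≠ B) : 0 < contract (stress μ A - stress μ B) (A - B) := by
  have hA := h.stress_subgradient hAB
  have hB := h.stress_subgradient hAB.symm
  rw [contract_sub_right] at hA hB
  rw [contract_sub_left, contract_sub_right, contract_sub_right]
  linarith

end Potentials

/-! ### The ideal and the composite rheology -/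

section Rheology

variable {μ τ : ℝ}

lemma viscIdeal_eq_add (m μ τ s : ℝ) : viscIdeal m μ τ s = m + viscIdeal 0 μ τ s := by
  simp [viscIdeal]

lemma viscIdeal_zero_eq (hμ : 0 < μ) (hτ : 0 < τ) {s : ℝ} (hs : 0 ≤ s) :
    viscIdeal 0 μ τ s = τ * μ / max τ (2 * μ * s) := by
  rw [viscIdeal, zero_add]
  rcases hs.eq_or_lt with rfl | hs
  · rw [if_pos rfl, mul_zero, max_eq_left hτ.le]
    field_simp
  · rw [if_neg hs.ne']
    rcases le_total τ (2 * μ * s) with h | h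
    · rw [max_eq_right h, min_eq_left (by rw [div_le_iff₀ (by positivity)]; linarith)]
      field_simp
    · rw [max_eq_left h, min_eq_right (by rw [le_div_iff₀ (by positivity)]; linarith)]
      field_simp

lemma two_mul_viscIdeal_zero_mul (hμ : 0 < μ) (hτ : 0 < τ) {s : ℝ} (hs : 0 ≤ s) :
    2 * viscIdeal 0 μ τ s * s = min τ (2 * μ * s) := by
  have hmax : 0 < max τ (2 * μ * s) := lt_max_of_lt_left hτ
  rw [viscIdeal_zero_eq hμ hτ hs, eq_comm, ← mul_right_cancel_iff_of_pos hmax, min_mul_max]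
  field_simp

lemma continuousOn_viscIdeal_zero (hμ : 0 < μ) (hτ : 0 < τ) :
    ContinuousOn (viscIdeal 0 μ τ) (Set.Ici 0) := by
  refine ContinuousOn.congr (Continuous.continuousOn ?_) fun s hs => viscIdeal_zero_eq hμ hτ hs
  exact continuous_const.div (by fun_prop) fun s => (lt_max_of_lt_left hτ).ne'

lemma two_mul_viscComposite_mul_le (hμ : 0 < μ) (hτ : 0 < τ) {s : ℝ} (hs : 0 ≤ s) :
    2 * viscComposite μ τ s * s ≤ τ := by
  rw [viscComposite, mul_div_assoc', div_mul_eq_mul_div, div_le_iff₀ (by positivity)]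
  nlinarith [sq_nonneg τ]

lemma le_phiIdeal (hμ : 0 < μ) {η : ℝ} (hη : η ≤ τ) (t : ℝ) :
    2 * η * t - η ^ 2 / (2 * μ) + τ ^ 2 / (2 * μ) ≤ phiIdeal μ τ t := by
  rw [phiIdeal]
  split_ifs with h
  · have : 2 * μ * t ^ 2 - 2 * η * t + η ^ 2 / (2 * μ) = (2 * μ * t - η) ^ 2 / (2 * μ) := by
      field_simp
      ring
    have : 0 ≤ (2 * μ * t - η) ^ 2 / (2 * μ) := by positivity
    linarith
  · have : 2 * τ * t - 2 * η * t + η ^ 2 / (2 * μ) - τ ^ 2 / (2 * μ)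
        = (τ - η) * (4 * μ * t - η - τ) / (2 * μ) := by
      field_simp
      ring
    have : 0 ≤ (τ - η) * (4 * μ * t - η - τ) / (2 * μ) :=
      div_nonneg (mul_nonneg (by linarith) (by linarith)) (by positivity)
    linarith

lemma phiIdeal_eq (hμ : 0 < μ) (s : ℝ) :
    phiIdeal μ τ s = 2 * min τ (2 * μ * s) * s - min τ (2 * μ * s) ^ 2 / (2 * μ)
      + τ ^ 2 / (2 * μ) := by
  rw [phiIdeal]
  split_ifs with h
  · rw [min_eq_right h]
    field_simp
    ring
  · rw [min_eq_left (not_le.1 h).le]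
    ring

/-- Legendre duality: `phiIdeal` is, up to a constant, the supremum over the stresses `η ≤ τ` of
`2 η s - η ^ 2 / (2 μ)`, attained at `η = 2 μ(s) s`. -/
lemma isPotential_phiIdeal (hμ : 0 < μ) (hτ : 0 < τ) :
    IsPotential (phiIdeal μ τ) (viscIdeal 0 μ τ) where
  nonneg s hs := by
    rw [viscIdeal_zero_eq hμ hτ hs]
    positivity
  le s t hs _ := by
    have hstress := two_mul_viscIdeal_zero_mul hμ hτ hs
    have hdual := le_phiIdeal hμ (min_le_left τ (2 * μ * s)) t
    rw [phiIdeal_eq hμ s]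
    linear_combination hdual + 2 * (t - s) * hstress

lemma isPotential_phiIdeal_add_sq (hμ : 0 < μ) (hτ : 0 < τ) {m : ℝ} (hm : 0 ≤ m) :
    IsPotential (fun s => phiIdeal μ τ s + 2 * m * s ^ 2) (viscIdeal m μ τ) := by
  simpa only [← viscIdeal_eq_add] using (isPotential_phiIdeal hμ hτ).add_sq hm

lemma isStrictPotential_phiIdeal_add_sq (hμ : 0 < μ) (hτ : 0 < τ) {m : ℝ} (hm : 0 < m) :
    IsStrictPotential (fun s => phiIdeal μ τ s + 2 * m * s ^ 2) (viscIdeal m μ τ) := by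
  simpa only [← viscIdeal_eq_add] using (isPotential_phiIdeal hμ hτ).isStrictPotential_add_sq hm

lemma isStrictPotential_phiComposite (hμ : 0 < μ) (hτ : 0 < τ) :
    IsStrictPotential (phiComposite μ τ) (viscComposite μ τ) where
  pos s hs := by
    unfold viscComposite
    positivity
  lt s t hs ht hst := by
    have hs' : 0 < τ + 2 * μ * s := by positivity
    have ht' : 0 < τ + 2 * μ * t := by positivity
    have hne : (τ + 2 * μ * t) / (τ + 2 * μ * s) ≠ 1 := by
      rw [Ne, div_eq_one_iff_eq hs'.ne']
      intro h
      exact hst (mul_left_cancel₀ (mul_pos two_pos hμ).ne' (by linarith))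
    have hlog := Real.log_lt_sub_one_of_pos (div_pos ht' hs') hne
    rw [Real.log_div ht'.ne' hs'.ne'] at hlog
    have hscaled := mul_lt_mul_of_pos_left hlog (show 0 < τ ^ 2 / μ by positivity)
    have hslope : 4 * viscComposite μ τ s * s * (t - s)
        = 2 * τ * (t - s) - τ ^ 2 / μ * ((τ + 2 * μ * t) / (τ + 2 * μ * s) - 1) := by
      rw [viscComposite, show 2 * s * μ + τ = τ + 2 * μ * s by ring]
      field_simp
      ring
    rw [hslope]
    unfold phiComposite
    linarith

end Rheology

/-! ### Minimization of strongly convex functionals -/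

section Minimization

variable {X : Type*} [NormedAddCommGroup X] [NormedSpace ℝ X]

/-- `J` is strongly convex with modulus `c` and `A x` is a subgradient of `J` at every point `x`. -/
def HasStrongSubgradient (J : X → ℝ) (A : X → X →L[ℝ] ℝ) (c : ℝ) : Prop :=
  ∀ x y, J x + A x (y - x) + c * ‖y - x‖ ^ 2 ≤ J y

variable {J : X → ℝ} {A : X → X →L[ℝ] ℝ} {c : ℝ}

lemma HasStrongSubgradient.bddBelow_range (hJ : HasStrongSubgradient J A c) (hc : 0 < c) :
    BddBelow (Set.range J) := by
  refine ⟨J 0 - ‖A 0‖ ^ 2 / (4 * c), ?_⟩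
  rintro _ ⟨y, rfl⟩
  have hsub := hJ 0 y
  rw [sub_zero] at hsub
  have hop : -(‖A 0‖ * ‖y‖) ≤ A 0 y := (abs_le.1 ((A 0).le_opNorm y)).1
  have hyoung : ‖A 0‖ * ‖y‖ - c * ‖y‖ ^ 2 ≤ ‖A 0‖ ^ 2 / (4 * c) := by
    rw [le_div_iff₀ (by positivity)]
    nlinarith [sq_nonneg (‖A 0‖ - 2 * c * ‖y‖)]
  linarith

lemma HasStrongSubgradient.mul_norm_sub_sq_le (hJ : HasStrongSubgradient J A c) {m : ℝ}
    (hm : ∀ x, m ≤ J x) (x y : X) : c / 2 * ‖x - y‖ ^ 2 ≤ (J x - m) + (J y - m) := by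
  set z := (1 / 2 : ℝ) • (x + y) with hz
  have hxz : x - z = (1 / 2 : ℝ) • (x - y) := by rw [hz]; module
  have hyz : y - z = -((1 / 2 : ℝ) • (x - y)) := by rw [hz]; module
  have hx := hJ z x
  have hy := hJ z y
  rw [hxz, norm_smul, mul_pow] at hx
  rw [hyz, norm_neg, map_neg, norm_smul, mul_pow] at hy
  norm_num at hx hy
  linarith [hm z]

lemma HasStrongSubgradient.cauchySeq (hJ : HasStrongSubgradient J A c) (hc : 0 < c) {m : ℝ}
    (hm : ∀ x, m ≤ J x) {u : ℕ → X} (hu : ∀ n : ℕ, J (u n) < m + 1 / ((n : ℝ) + 1)) :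
    CauchySeq u := by
  have hlim : Tendsto (fun n : ℕ => Real.sqrt (4 / c * (1 / ((n : ℝ) + 1)))) atTop (𝓝 0) := by
    have := ((tendsto_one_div_add_atTop_nhds_zero_nat (𝕜 := ℝ)).const_mul (4 / c)).sqrt
    rwa [mul_zero, Real.sqrt_zero] at this
  refine cauchySeq_of_le_tendsto_0 _ (fun n k N hn hk => ?_) hlim
  rw [dist_eq_norm]
  apply Real.le_sqrt_of_sq_le
  have hn' : 1 / ((n : ℝ) + 1) ≤ 1 / ((N : ℝ) + 1) := by gcongr
  have hk' : 1 / ((k : ℝ) + 1) ≤ 1 / ((N : ℝ) + 1) := by gcongr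
  have hdist : c / 2 * ‖u n - u k‖ ^ 2 ≤ 2 * (1 / ((N : ℝ) + 1)) := by
    linarith [hJ.mul_norm_sub_sq_le hm (u n) (u k), hu n, hu k]
  rw [div_mul_eq_mul_div, le_div_iff₀ hc]
  linarith

lemma HasStrongSubgradient.exists_forall_le [CompleteSpace X] (hJ : HasStrongSubgradient J A c)
    (hc : 0 < c) : ∃ x, ∀ y, J x ≤ J y := by
  have hle : ∀ x, iInf J ≤ J x := ciInf_le (hJ.bddBelow_range hc)
  choose u hu using fun n : ℕ =>
    exists_lt_of_ciInf_lt (lt_add_of_pos_right (iInf J) (Nat.one_div_pos_of_nat (α := ℝ) (n := n)))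
  obtain ⟨x, hx⟩ := cauchySeq_tendsto_of_complete (hJ.cauchySeq hc hle hu)
  refine ⟨x, fun y => le_trans ?_ (hle y)⟩
  have hlower : Tendsto (fun n => J x + A x (u n - x)) atTop (𝓝 (J x)) := by
    simpa using (((A x).continuous.tendsto _).comp (hx.sub_const x)).const_add (J x)
  have hupper : Tendsto (fun n : ℕ => iInf J + 1 / ((n : ℝ) + 1)) atTop (𝓝 (iInf J)) := by
    simpa using (tendsto_one_div_add_atTop_nhds_zero_nat (𝕜 := ℝ)).const_add (iInf J)
  refine le_of_tendsto_of_tendsto' hlower hupper fun n => ?_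
  have : 0 ≤ c * ‖u n - x‖ ^ 2 := by positivity
  linarith [hJ x (u n), hu n]

lemma HasStrongSubgradient.eq_zero_of_forall_le (hJ : HasStrongSubgradient J A c) (hc : 0 < c)
    (hA : ∀ x v, Tendsto (fun t : ℝ => A (x + t • v) v) (𝓝[>] 0) (𝓝 (A x v))) {x : X}
    (hx : ∀ y, J x ≤ J y) : A x = 0 := by
  have hnonneg : ∀ v, 0 ≤ A x v := by
    intro v
    refine ge_of_tendsto (hA x v) ?_
    filter_upwards [self_mem_nhdsWithin] with t (ht : 0 < t)
    have hsub := hJ (x + t • v) x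
    rw [show x - (x + t • v) = -(t • v) by abel, map_neg, map_smul, smul_eq_mul] at hsub
    have : 0 ≤ c * ‖-(t • v)‖ ^ 2 := by positivity
    exact nonneg_of_mul_nonneg_right (a := t) (by linarith [hx (x + t • v)]) ht
  ext v
  have := hnonneg (-v)
  rw [map_neg] at this
  exact le_antisymm (neg_nonneg.1 this) (hnonneg v)

end Minimization

/-! ### Convexity of integral functionals -/

section Convexity

lemma convexOn_of_subgradient {E : Type*} [AddCommGroup E] [Module ℝ E] {s : Set E} {F : E → ℝ}
    (hs : Convex ℝ s) (h : ∀ x ∈ s, ∃ ℓ : E →ₗ[ℝ] ℝ, ∀ y ∈ s, F x + ℓ (y - x) ≤ F y) :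
    ConvexOn ℝ s F := by
  refine ⟨hs, fun x hx y hy a b ha hb hab => ?_⟩
  obtain ⟨ℓ, hℓ⟩ := h _ (hs hx hy ha hb hab)
  obtain rfl : a = 1 - b := eq_sub_of_add_eq hab
  set z := (1 - b) • x + b • y with hz
  have hxz : x - z = b • (x - y) := by rw [hz]; module
  have hyz : y - z = -((1 - b) • (x - y)) := by rw [hz]; module
  have hx' := mul_le_mul_of_nonneg_left (hℓ x hx) ha
  have hy' := mul_le_mul_of_nonneg_left (hℓ y hy) hb
  rw [hxz, map_smul, smul_eq_mul] at hx'
  rw [hyz, map_neg, map_smul, smul_eq_mul] at hy'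
  simp only [smul_eq_mul]
  linarith

lemma strictConvexOn_of_subgradient {E : Type*} [AddCommGroup E] [Module ℝ E] {s : Set E}
    {F : E → ℝ} (hs : Convex ℝ s)
    (h : ∀ x ∈ s, ∃ ℓ : E →ₗ[ℝ] ℝ, ∀ y ∈ s, x ≠ y → F x + ℓ (y - x) < F y) :
    StrictConvexOn ℝ s F := by
  refine ⟨hs, fun x hx y hy hxy a b ha hb hab => ?_⟩
  obtain ⟨ℓ, hℓ⟩ := h _ (hs hx hy ha.le hb.le hab)
  obtain rfl : a = 1 - b := eq_sub_of_add_eq hab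
  set z := (1 - b) • x + b • y with hz
  have hxz : x - z = b • (x - y) := by rw [hz]; module
  have hyz : y - z = -((1 - b) • (x - y)) := by rw [hz]; module
  have hxy0 := sub_ne_zero.2 hxy
  have hzx : z ≠ x := fun h => smul_ne_zero hb.ne' hxy0 (by rw [← hxz, h, sub_self])
  have hzy : z ≠ y := fun h =>
    neg_ne_zero.2 (smul_ne_zero ha.ne' hxy0) (by rw [← hyz, h, sub_self])
  have hx' := mul_lt_mul_of_pos_left (hℓ x hx hzx) ha
  have hy' := mul_lt_mul_of_pos_left (hℓ y hy hzy) hb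
  rw [hxz, map_smul, smul_eq_mul] at hx'
  rw [hyz, map_neg, map_smul, smul_eq_mul] at hy'
  simp only [smul_eq_mul]
  linarith

variable {α : Type*} [MeasurableSpace α] {ν : Measure α}

lemma integral_lt_integral_of_ae_le {f g : α → ℝ} (hf : Integrable f ν) (hg : Integrable g ν)
    (hle : f ≤ᵐ[ν] g) (hne : ¬f =ᵐ[ν] g) : ∫ x, f x ∂ν < ∫ x, g x ∂ν :=
  (integral_mono_ae hf hg hle).lt_of_ne fun h =>
    hne ((integral_eq_iff_of_ae_le hf hg hle).1 h)

variable {X E : Type*} [AddCommGroup X] [Module ℝ X] [AddCommGroup E] [Module ℝ E] {S : Set X}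
  {T : X → α → E} {Ψ : α → E → ℝ}

lemma convexOn_integral_comp (hS : Convex ℝ S)
    (hT : ∀ u ∈ S, ∀ v ∈ S, ∀ a b : ℝ, T (a • u + b • v) =ᵐ[ν] a • T u + b • T v)
    (hint : ∀ u ∈ S, Integrable (fun x => Ψ x (T u x)) ν)
    (hΨ : ∀ᵐ x ∂ν, ConvexOn ℝ Set.univ (Ψ x)) :
    ConvexOn ℝ S fun u => ∫ x, Ψ x (T u x) ∂ν := by
  refine ⟨hS, fun u hu v hv a b ha hb hab => ?_⟩
  simp only [smul_eq_mul]
  rw [← integral_const_mul, ← integral_const_mul,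
    ← integral_add ((hint u hu).const_mul a) ((hint v hv).const_mul b)]
  refine integral_mono_ae (hint _ (hS hu hv ha hb hab))
    (((hint u hu).const_mul a).add ((hint v hv).const_mul b)) ?_
  filter_upwards [hΨ, hT u hu v hv a b] with x hx hTx
  rw [hTx]
  exact hx.2 (Set.mem_univ _) (Set.mem_univ _) ha hb hab

lemma strictConvexOn_integral_comp (hS : Convex ℝ S)
    (hT : ∀ u ∈ S, ∀ v ∈ S, ∀ a b : ℝ, T (a • u + b • v) =ᵐ[ν] a • T u + b • T v)
    (hinj : ∀ u ∈ S, ∀ v ∈ S, T u =ᵐ[ν] T v → u = v)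
    (hint : ∀ u ∈ S, Integrable (fun x => Ψ x (T u x)) ν)
    (hΨ : ∀ᵐ x ∂ν, StrictConvexOn ℝ Set.univ (Ψ x)) :
    StrictConvexOn ℝ S fun u => ∫ x, Ψ x (T u x) ∂ν := by
  refine ⟨hS, fun u hu v hv huv a b ha hb hab => ?_⟩
  simp only [smul_eq_mul]
  rw [← integral_const_mul, ← integral_const_mul,
    ← integral_add ((hint u hu).const_mul a) ((hint v hv).const_mul b)]
  refine integral_lt_integral_of_ae_le (hint _ (hS hu hv ha.le hb.le hab))
    (((hint u hu).const_mul a).add ((hint v hv).const_mul b)) ?_ fun heq => huv (hinj u hu v hv ?_)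
  · filter_upwards [hΨ, hT u hu v hv a b] with x hx hTx
    rw [hTx]
    exact hx.convexOn.2 (Set.mem_univ _) (Set.mem_univ _) ha.le hb.le hab
  · filter_upwards [hΨ, hT u hu v hv a b, heq] with x hx hTx heq
    by_contra hne
    rw [hTx] at heq
    exact (hx.2 (Set.mem_univ _) (Set.mem_univ _) hne ha hb hab).ne heq

end Convexity

/-! ### Partial derivatives and test functions -/

section PartialDerivatives

variable {d : ℕ} {F : Type*} [NormedAddCommGroup F] [NormedSpace ℝ F] {x : Vec d}

lemma contDiff_coord (i : Fin d) : ContDiff ℝ ∞ fun x : Vec d => x i :=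
  contDiff_euclidean.1 contDiff_id i

lemma contDiff_partialDeriv {ψ : Vec d → F} (h : ContDiff ℝ ∞ ψ) (j : Fin d) :
    ContDiff ℝ ∞ (partialDeriv j ψ) :=
  (h.fderiv_right (by simp)).clm_apply contDiff_const

lemma partialDeriv_coord {w : Vec d → Vec d} (h : DifferentiableAt ℝ w x) (i j : Fin d) :
    partialDeriv j (fun y => w y i) x = partialDeriv j w x i := by
  have : HasFDerivAt (fun y => w y i) ((EuclideanSpace.proj i).comp (fderiv ℝ w x)) x :=
    (EuclideanSpace.proj i : Vec d →L[ℝ] ℝ).hasFDerivAt.comp x h.hasFDerivAt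
  rw [partialDeriv, this.fderiv]
  rfl

lemma partialDeriv_coord_id (i j : Fin d) (x : Vec d) :
    partialDeriv j (fun x : Vec d => x i) x = if i = j then 1 else 0 := by
  rw [partialDeriv_coord (w := fun y => y) differentiableAt_id]
  simp [partialDeriv, PiLp.single_apply]

lemma partialDeriv_add {ψ χ : Vec d → F} (h : DifferentiableAt ℝ ψ x)
    (h' : DifferentiableAt ℝ χ x) (j : Fin d) :
    partialDeriv j (fun y => ψ y + χ y) x = partialDeriv j ψ x + partialDeriv j χ x := by
  rw [partialDeriv, fderiv_fun_add h h']
  rfl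

lemma partialDeriv_const_smul {ψ : Vec d → F} (h : DifferentiableAt ℝ ψ x) (c : ℝ) (j : Fin d) :
    partialDeriv j (fun y => c • ψ y) x = c • partialDeriv j ψ x := by
  rw [partialDeriv, fderiv_fun_const_smul h]
  rfl

lemma partialDeriv_smul {a : Vec d → ℝ} {ψ : Vec d → F} (ha : DifferentiableAt ℝ a x)
    (hψ : DifferentiableAt ℝ ψ x) (j : Fin d) :
    partialDeriv j (fun y => a y • ψ y) x
      = a x • partialDeriv j ψ x + partialDeriv j a x • ψ x := by
  rw [partialDeriv, fderiv_fun_smul ha hψ]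
  rfl

lemma partialDeriv_mul {a b : Vec d → ℝ} (ha : DifferentiableAt ℝ a x)
    (hb : DifferentiableAt ℝ b x) (j : Fin d) :
    partialDeriv j (fun y => a y * b y) x = a x * partialDeriv j b x + partialDeriv j a x * b x :=
  partialDeriv_smul ha hb j

lemma partialDeriv_comp {a : Vec d → ℝ} {H : ℝ → ℝ} {H' : ℝ} (hH : HasDerivAt H H' (a x))
    (ha : DifferentiableAt ℝ a x) (j : Fin d) :
    partialDeriv j (fun y => H (a y)) x = H' * partialDeriv j a x := by
  have : HasFDerivAt (fun y => H (a y)) (H' • fderiv ℝ a x) x :=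
    hH.comp_hasFDerivAt x ha.hasFDerivAt
  rw [partialDeriv, this.fderiv]
  rfl

lemma partialDeriv_norm_sq (j : Fin d) (x : Vec d) :
    partialDeriv j (fun y : Vec d => ‖y‖ ^ 2) x = 2 * x j := by
  rw [partialDeriv, fderiv_norm_sq_apply]
  simp [EuclideanSpace.inner_single_right]

lemma partialDeriv_comm {ψ : Vec d → F} (h : ContDiff ℝ ∞ ψ) (i j : Fin d) (x : Vec d) :
    partialDeriv i (partialDeriv j ψ) x = partialDeriv j (partialDeriv i ψ) x := by
  have hsymm : IsSymmSndFDerivAt ℝ ψ x := (h.contDiffAt (x := x)).isSymmSndFDerivAt (by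
    simp only [minSmoothness_of_isRCLikeNormedField]; exact ENat.LEInfty.out)
  have hdiff : DifferentiableAt ℝ (fderiv ℝ ψ) x :=
    (h.fderiv_right (m := ∞) (by simp)).differentiable (by simp) x
  have hsecond : ∀ k l : Fin d, partialDeriv k (partialDeriv l ψ) x
      = fderiv ℝ (fderiv ℝ ψ) x (EuclideanSpace.single k 1) (EuclideanSpace.single l 1) := by
    intro k l
    unfold partialDeriv
    rw [fderiv_clm_apply hdiff (differentiableAt_const _)]
    simp
  rw [hsecond, hsecond]
  exact hsymm _ _

end PartialDerivatives

section TestFunctions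

variable {d : ℕ} {Ω : Set (Vec d)} {F : Type*} [NormedAddCommGroup F] [NormedSpace ℝ F]

lemma IsTest.differentiable {ψ : Vec d → F} (h : IsTest Ω ψ) : Differentiable ℝ ψ :=
  h.1.differentiable (by simp)

lemma IsTest.add {ψ χ : Vec d → F} (h : IsTest Ω ψ) (h' : IsTest Ω χ) :
    IsTest Ω (fun x => ψ x + χ x) :=
  ⟨h.1.add h'.1, h.2.1.add h'.2.1, (tsupport_add ψ χ).trans (Set.union_subset h.2.2 h'.2.2)⟩

lemma IsTest.const_smul {ψ : Vec d → F} (h : IsTest Ω ψ) (c : ℝ) :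
    IsTest Ω (fun x => c • ψ x) :=
  ⟨h.1.const_smul c, h.2.1.smul_left (f := fun _ => c),
    (tsupport_smul_subset_right (fun _ => c) ψ).trans h.2.2⟩

lemma IsTest.mul_left {a ψ : Vec d → ℝ} (ha : ContDiff ℝ ∞ a) (h : IsTest Ω ψ) :
    IsTest Ω (fun x => a x * ψ x) :=
  ⟨ha.mul h.1, h.2.1.mul_left, tsupport_mul_subset_right.trans h.2.2⟩

lemma isTest_zero : IsTest Ω (fun _ : Vec d => (0 : F)) :=
  ⟨contDiff_const, HasCompactSupport.zero, by
    rw [tsupport_eq_empty_iff.2 (rfl : (fun _ : Vec d => (0 : F)) = 0)]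
    exact Set.empty_subset Ω⟩

lemma IsTest.pderiv {ψ : Vec d → F} (h : IsTest Ω ψ) (j : Fin d) :
    IsTest Ω (partialDeriv j ψ) :=
  ⟨contDiff_partialDeriv h.1 j, h.2.1.fderiv_apply ℝ _,
    (tsupport_fderiv_apply_subset ℝ _).trans h.2.2⟩

lemma IsTest.coord {w : Vec d → Vec d} (h : IsTest Ω w) (i : Fin d) :
    IsTest Ω (fun x => w x i) :=
  ⟨contDiff_euclidean.1 h.1 i, h.2.1.comp_left (g := fun v : Vec d => v i) rfl,
    (closure_mono (Function.support_comp_subset (g := fun v : Vec d => v i) rfl w)).trans h.2.2⟩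

lemma IsTest.eq_zero {ψ : Vec d → F} (h : IsTest Ω ψ) {x : Vec d} (hx : x ∉ Ω) : ψ x = 0 :=
  image_eq_zero_of_notMem_tsupport fun hx' => hx (h.2.2 hx')

lemma IsTest.memLp {ψ : Vec d → F} (h : IsTest Ω ψ) (S : Set (Vec d)) (p : ENNReal) :
    MemLp ψ p (volume.restrict S) :=
  h.1.continuous.memLp_of_hasCompactSupport h.2.1

lemma IsTest.integrable_mul {a b : Vec d → ℝ} (ha : IsTest Ω a) (hb : IsTest Ω b) :
    IntegrableOn (fun x => a x * b x) Ω :=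
  (ha.memLp Ω 2).integrable_mul (hb.memLp Ω 2)

lemma integral_mul_partialDeriv {a ψ : Vec d → ℝ} (ha : ContDiff ℝ ∞ a) (h : IsTest Ω ψ)
    (j : Fin d) :
    ∫ x in Ω, a x * partialDeriv j ψ x = -∫ x in Ω, partialDeriv j a x * ψ x := by
  rw [setIntegral_eq_integral_of_forall_compl_eq_zero fun x hx => by
      rw [(h.pderiv j).eq_zero hx, mul_zero],
    setIntegral_eq_integral_of_forall_compl_eq_zero fun x hx => by rw [h.eq_zero hx, mul_zero]]
  have hint : ∀ {b χ : Vec d → ℝ}, ContDiff ℝ ∞ b → IsTest Ω χ → Integrable fun x => b x * χ x :=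
    fun hb hχ => (hb.continuous.mul hχ.1.continuous).integrable_of_hasCompactSupport
      hχ.2.1.mul_left
  exact integral_mul_fderiv_eq_neg_fderiv_mul_of_integrable
    (hint (contDiff_partialDeriv ha j) h) (hint ha (h.pderiv j)) (hint ha h)
    (fun x _ => ha.differentiable (by simp) x) (fun x _ => h.differentiable x)

lemma IsTest.integral_partialDeriv_mul_comm {a b : Vec d → ℝ} (ha : IsTest Ω a) (hb : IsTest Ω b)
    (i j : Fin d) :
    ∫ x in Ω, partialDeriv j a x * partialDeriv i b x
      = ∫ x in Ω, partialDeriv i a x * partialDeriv j b x := by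
  have hij := integral_mul_partialDeriv ha.1 (hb.pderiv i) j
  have hji := integral_mul_partialDeriv ha.1 (hb.pderiv j) i
  simp only [partialDeriv_comm hb.1 i j] at hji
  linarith

lemma IsTest.integral_sq_eq {ψ : Vec d → ℝ} (h : IsTest Ω ψ) (j : Fin d) :
    ∫ x in Ω, ψ x * ψ x = -2 * ∫ x in Ω, x j * ψ x * partialDeriv j ψ x := by
  have hcoord := contDiff_coord (d := d) j
  have hparts := integral_mul_partialDeriv (hcoord.mul h.1) h j
  have hprod : ∀ x, partialDeriv j (fun x => x j * ψ x) x * ψ x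
      = x j * ψ x * partialDeriv j ψ x + ψ x * ψ x := by
    intro x
    rw [partialDeriv_mul (hcoord.differentiable (by simp) x) (h.differentiable x),
      partialDeriv_coord_id, if_pos rfl]
    ring
  simp only [hprod] at hparts
  rw [integral_add ((h.mul_left hcoord).integrable_mul (h.pderiv j)) (h.integrable_mul h)]
    at hparts
  linarith

/-- Young's inequality is applied to the mixed term `-2 x_j ψ ∂_j ψ`. -/
lemma IsTest.poincare {ψ : Vec d → ℝ} (h : IsTest Ω ψ) (hΩ : MeasurableSet Ω) (j : Fin d) {R : ℝ}
    (hR : ∀ x ∈ Ω, |x j| ≤ R) :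
    ∫ x in Ω, ψ x * ψ x
      ≤ 4 * R ^ 2 * ∫ x in Ω, partialDeriv j ψ x * partialDeriv j ψ x := by
  have hψ := h.integrable_mul h
  have hdψ := (h.pderiv j).integrable_mul (h.pderiv j)
  have hmixed := (h.mul_left (contDiff_coord j)).integrable_mul (h.pderiv j)
  have hyoung : -2 * ∫ x in Ω, x j * ψ x * partialDeriv j ψ x
      ≤ 1 / 2 * (∫ x in Ω, ψ x * ψ x) + 2 * R ^ 2 *
        ∫ x in Ω, partialDeriv j ψ x * partialDeriv j ψ x := by
    rw [← integral_const_mul, ← integral_const_mul, ← integral_const_mul,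
      ← integral_add (hψ.const_mul _) (hdψ.const_mul _)]
    refine setIntegral_mono_on (hmixed.const_mul _) ((hψ.const_mul _).add (hdψ.const_mul _)) hΩ
      fun x hx => ?_
    have hx : x j ^ 2 ≤ R ^ 2 := sq_le_sq' (abs_le.1 (hR x hx)).1 (abs_le.1 (hR x hx)).2
    have := mul_le_mul_of_nonneg_right hx (sq_nonneg (partialDeriv j ψ x))
    nlinarith [sq_nonneg (ψ x + 2 * x j * partialDeriv j ψ x)]
  linarith [h.integral_sq_eq j]

/-- The gradient of a differentiable field, with entries `∂ⱼ uᵢ` as in `IsWeakGradient`. -/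
def classicalGradient (u : Vec d → Vec d) (x : Vec d) : Tensor d :=
  Matrix.of fun i j => partialDeriv j u x i

lemma classicalGradient_apply (u : Vec d → Vec d) (x : Vec d) (i j : Fin d) :
    classicalGradient u x i j = partialDeriv j u x i := rfl

lemma IsTest.gradient_entry {w : Vec d → Vec d} (h : IsTest Ω w) (i j : Fin d) :
    IsTest Ω fun x => classicalGradient w x i j :=
  (h.pderiv j).coord i

lemma IsTest.isWeakGradient {w : Vec d → Vec d} (h : IsTest Ω w) :
    IsWeakGradient Ω w (classicalGradient w) := by
  refine ⟨fun i j => (h.gradient_entry i j).memLp Ω 2, fun ψ hψ i j => ?_⟩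
  rw [integral_mul_partialDeriv (h.coord i).1 hψ j]
  simp only [partialDeriv_coord (h.differentiable _), classicalGradient_apply]

end TestFunctions

/-! ### The Sobolev space as a closed graph -/

section LpLemmas

variable {α : Type*} [MeasurableSpace α] {ν : Measure α}

lemma tendsto_Lp_iff_tendsto_eLpNorm_sub {E : Type*} [NormedAddCommGroup E] {p : ENNReal}
    [Fact (1 ≤ p)] {u : ℕ → Lp E p ν} {u₀ : Lp E p ν} {w : ℕ → α → E} {w₀ : α → E}
    (hu : ∀ n, u n =ᵐ[ν] w n) (hu₀ : u₀ =ᵐ[ν] w₀) :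
    Tendsto u atTop (𝓝 u₀) ↔
      Tendsto (fun n => eLpNorm (fun x => w₀ x - w n x) p ν) atTop (𝓝 0) := by
  rw [Lp.tendsto_Lp_iff_tendsto_eLpNorm']
  have hnorm : ∀ n, eLpNorm (⇑(u n) - ⇑u₀) p ν = eLpNorm (fun x => w₀ x - w n x) p ν := by
    intro n
    rw [← eLpNorm_neg]
    refine eLpNorm_congr_ae ?_
    filter_upwards [hu n, hu₀] with x hx hx₀
    rw [Pi.neg_apply, Pi.sub_apply, hx, hx₀, neg_sub]
  simp only [hnorm]

lemma inner_toLp_eq_integral_mul {ψ : α → ℝ} (hψ : MemLp ψ 2 ν) (v : Lp ℝ 2 ν) :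
    inner ℝ hψ.toLp v = ∫ x, v x * ψ x ∂ν := by
  rw [L2.inner_def]
  refine integral_congr_ae ?_
  filter_upwards [hψ.coeFn_toLp] with x hx
  rw [hx]
  rfl

end LpLemmas

section SobolevGraph

variable {d : ℕ} {Ω : Set (Vec d)}

/-- Square-integrable tensor fields, entry by entry. -/
abbrev TensorL2 {d : ℕ} (Ω : Set (Vec d)) : Type :=
  Fin d → Fin d → Lp ℝ 2 (volume.restrict Ω)

/-- A representative of a square-integrable tensor field, as a function of the point. -/
def tensorField (g : TensorL2 Ω) (x : Vec d) : Tensor d := Matrix.of fun i j => g i j x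

lemma tensorField_apply (g : TensorL2 Ω) (x : Vec d) (i j : Fin d) :
    tensorField g x i j = g i j x := rfl

lemma ae_eq_of_entries {α : Type*} [MeasurableSpace α] {ν : Measure α} {G H : α → Tensor d}
    (h : ∀ i j, ∀ᵐ x ∂ν, G x i j = H x i j) : G =ᵐ[ν] H := by
  filter_upwards [ae_all_iff.2 fun i => ae_all_iff.2 (h i)] with x hx
  ext i j
  exact hx i j

lemma tensorField_add (g h : TensorL2 Ω) :
    tensorField (g + h) =ᵐ[volume.restrict Ω] fun x => tensorField g x + tensorField h x :=
  ae_eq_of_entries fun i j => Lp.coeFn_add (g i j) (h i j)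

lemma tensorField_smul (c : ℝ) (g : TensorL2 Ω) :
    tensorField (c • g) =ᵐ[volume.restrict Ω] fun x => c • tensorField g x :=
  ae_eq_of_entries fun i j => Lp.coeFn_smul c (g i j)

/-- The graph of the classical gradient on test functions: a space whose closure describes
`H₀¹(Ω)ᵈ`. -/
def testGraph (Ω : Set (Vec d)) : Submodule ℝ (L2 Ω × TensorL2 Ω) where
  carrier := {z | ∃ w : Vec d → Vec d, IsTest Ω w ∧ z.1 =ᵐ[volume.restrict Ω] w ∧
    tensorField z.2 =ᵐ[volume.restrict Ω] classicalGradient w}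
  zero_mem' := by
    refine ⟨fun _ => 0, isTest_zero, Lp.coeFn_zero _ _ _, ae_eq_of_entries fun i j => ?_⟩
    filter_upwards [Lp.coeFn_zero ℝ 2 (volume.restrict Ω)] with x hx
    refine hx.trans ?_
    simp [classicalGradient_apply, partialDeriv]
  add_mem' := by
    rintro z z' ⟨w, hw, hz, hgrad⟩ ⟨w', hw', hz', hgrad'⟩
    refine ⟨_, hw.add hw', ?_, ?_⟩
    · filter_upwards [Lp.coeFn_add z.1 z'.1, hz, hz'] with x hadd hx hx'
      rw [Prod.fst_add, hadd, Pi.add_apply, hx, hx']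
    · filter_upwards [tensorField_add z.2 z'.2, hgrad, hgrad'] with x hadd hx hx'
      rw [Prod.snd_add, hadd, hx, hx']
      ext i j
      simp only [classicalGradient_apply, Matrix.add_apply, PiLp.add_apply,
        partialDeriv_add (hw.differentiable x) (hw'.differentiable x)]
  smul_mem' := by
    rintro c z ⟨w, hw, hz, hgrad⟩
    refine ⟨_, hw.const_smul c, ?_, ?_⟩
    · filter_upwards [Lp.coeFn_smul c z.1, hz] with x hsmul hx
      rw [Prod.smul_fst, hsmul, Pi.smul_apply, hx]
    · filter_upwards [tensorField_smul c z.2, hgrad] with x hsmul hx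
      rw [Prod.smul_snd, hsmul, hx]
      ext i j
      simp only [classicalGradient_apply, Matrix.smul_apply, PiLp.smul_apply,
        partialDeriv_const_smul (hw.differentiable x)]

/-- The graph of the weak gradient on `H₀¹(Ω)ᵈ`, see `mem_H10_iff`; being closed it is a Hilbert
space, unlike the set `H10 Ω` with the norm of `L2 Ω`. -/
def sobolevGraph (Ω : Set (Vec d)) : Submodule ℝ (L2 Ω × TensorL2 Ω) :=
  (testGraph Ω).topologicalClosure

lemma sobolevGraph_induction {P : L2 Ω × TensorL2 Ω → Prop} (hP : IsClosed {z | P z})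
    (h : ∀ z ∈ testGraph Ω, P z) {z : L2 Ω × TensorL2 Ω} (hz : z ∈ sobolevGraph Ω) : P z :=
  closure_minimal (s := (testGraph Ω : Set (L2 Ω × TensorL2 Ω))) h hP hz

lemma IsWeakGradient.congr {u v : Vec d → Vec d} {G H : Vec d → Tensor d}
    (h : IsWeakGradient Ω u G) (huv : u =ᵐ[volume.restrict Ω] v)
    (hGH : G =ᵐ[volume.restrict Ω] H) : IsWeakGradient Ω v H := by
  refine ⟨fun i j => (h.1 i j).ae_eq (hGH.mono fun x hx => by simp only [hx]),
    fun ψ hψ i j => ?_⟩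
  have hu : ∫ x in Ω, u x i * partialDeriv j ψ x = ∫ x in Ω, v x i * partialDeriv j ψ x :=
    integral_congr_ae (huv.mono fun x hx => by simp only [hx])
  have hG : ∫ x in Ω, G x i j * ψ x = ∫ x in Ω, H x i j * ψ x :=
    integral_congr_ae (hGH.mono fun x hx => by simp only [hx])
  rw [← hu, ← hG, h.2 ψ hψ i j]

lemma exists_inner_eq_integral_coord_mul {ψ : Vec d → ℝ} (hψ : MemLp ψ 2 (volume.restrict Ω))
    (i : Fin d) : ∃ a : L2 Ω, ∀ v : L2 Ω, inner ℝ a v = ∫ x in Ω, v x i * ψ x := by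
  have hsingle : MemLp (fun x => EuclideanSpace.single i (ψ x)) 2 (volume.restrict Ω) := by
    refine MemLp.of_eval_piLp fun k => ?_
    obtain rfl | hk := eq_or_ne k i
    · simpa using hψ
    · simp [hk]
  refine ⟨hsingle.toLp, fun v => ?_⟩
  rw [L2.inner_def]
  refine integral_congr_ae ?_
  filter_upwards [hsingle.coeFn_toLp] with x hx
  rw [hx, EuclideanSpace.inner_single_left, mul_comm]
  rfl

lemma isWeakGradient_tensorField {z : L2 Ω × TensorL2 Ω} (hz : z ∈ sobolevGraph Ω) :
    IsWeakGradient Ω z.1 (tensorField z.2) := by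
  refine ⟨fun i j => Lp.memLp (z.2 i j), fun ψ hψ i j => ?_⟩
  obtain ⟨a, ha⟩ := exists_inner_eq_integral_coord_mul ((hψ.pderiv j).memLp Ω 2) i
  have hb := inner_toLp_eq_integral_mul (hψ.memLp Ω 2)
  simp only [tensorField_apply, ← ha, ← hb]
  refine sobolevGraph_induction
    (P := fun z => inner ℝ a z.1 = -inner ℝ (hψ.memLp Ω 2).toLp (z.2 i j))
    (isClosed_eq (by fun_prop) (by fun_prop)) ?_ hz
  rintro z ⟨w, hw, hz, hgrad⟩
  rw [ha, hb]
  exact (hw.isWeakGradient.congr hz.symm hgrad.symm).2 ψ hψ i j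

lemma exists_mem_sobolevGraph {u : L2 Ω} (hu : u ∈ H10 Ω) : ∃ g, (u, g) ∈ sobolevGraph Ω := by
  obtain ⟨G, hG, w, hw, hlim, hlimG⟩ := hu
  have hentry := fun n i j => ((hw n).gradient_entry i j).memLp Ω 2
  refine ⟨fun i j => (hG.1 i j).toLp, mem_closure_of_tendsto (b := atTop)
    (f := fun n => (((hw n).memLp Ω 2).toLp, fun i j => (hentry n i j).toLp))
    (Tendsto.prodMk_nhds ?_ (tendsto_pi_nhds.2 fun i => tendsto_pi_nhds.2 fun j => ?_)) ?_⟩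
  · exact (tendsto_Lp_iff_tendsto_eLpNorm_sub (fun n => ((hw n).memLp Ω 2).coeFn_toLp) .rfl).2 hlim
  · exact (tendsto_Lp_iff_tendsto_eLpNorm_sub (fun n => (hentry n i j).coeFn_toLp)
      (hG.1 i j).coeFn_toLp).2 (hlimG i j)
  · exact Eventually.of_forall fun n => ⟨w n, hw n, ((hw n).memLp Ω 2).coeFn_toLp,
      ae_eq_of_entries fun i j => (hentry n i j).coeFn_toLp⟩

lemma mem_H10_of_mem_sobolevGraph {z : L2 Ω × TensorL2 Ω} (hz : z ∈ sobolevGraph Ω) :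
    z.1 ∈ H10 Ω := by
  obtain ⟨ζ, hζ, hlim⟩ := mem_closure_iff_seq_limit.1 hz
  choose w hw hfst hsnd using hζ
  refine ⟨tensorField z.2, isWeakGradient_tensorField hz, w, hw, ?_, fun i j => ?_⟩
  · exact (tendsto_Lp_iff_tendsto_eLpNorm_sub hfst .rfl).1
      ((continuous_fst.tendsto _).comp hlim)
  · have hentry : Continuous fun z : L2 Ω × TensorL2 Ω => z.2 i j := by fun_prop
    exact (tendsto_Lp_iff_tendsto_eLpNorm_sub
      (fun n => (hsnd n).mono fun x hx => congrFun (congrFun hx i) j) .rfl).1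
      ((hentry.tendsto _).comp hlim)

lemma mem_H10_iff {u : L2 Ω} : u ∈ H10 Ω ↔ ∃ g, (u, g) ∈ sobolevGraph Ω :=
  ⟨exists_mem_sobolevGraph, fun ⟨_, hg⟩ => mem_H10_of_mem_sobolevGraph hg⟩

lemma ae_eq_of_forall_integral_mul_test_eq (hΩ : IsOpen Ω) {a b : Vec d → ℝ}
    (ha : MemLp a 2 (volume.restrict Ω)) (hb : MemLp b 2 (volume.restrict Ω))
    (h : ∀ ψ : Vec d → ℝ, IsTest Ω ψ → ∫ x in Ω, a x * ψ x = ∫ x in Ω, b x * ψ x) :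
    a =ᵐ[volume.restrict Ω] b := by
  have hloc : LocallyIntegrableOn (fun x => a x - b x) Ω := by
    rw [locallyIntegrableOn_iff hΩ.isLocallyClosed]
    intro k hk hkc
    have : IsFiniteMeasure (volume.restrict k) := ⟨by simpa using hkc.measure_lt_top⟩
    exact ((ha.sub hb).mono_measure (Measure.restrict_mono hk le_rfl)).integrable one_le_two
  have hzero := hΩ.ae_eq_zero_of_integral_contDiff_smul_eq_zero hloc fun ψ hsmooth hcpt hsupp => by
    have hψ : IsTest Ω ψ := ⟨hsmooth, hcpt, hsupp⟩
    have hψ2 := hψ.memLp Ω 2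
    rw [← setIntegral_eq_integral_of_forall_compl_eq_zero (s := Ω)
      fun x hx => by rw [hψ.eq_zero hx, zero_smul]]
    simp only [smul_eq_mul, mul_comm (ψ _), sub_mul]
    have hsub := integral_sub (ha.integrable_mul hψ2) (hb.integrable_mul hψ2)
    simp only [Pi.mul_apply] at hsub
    rw [hsub, h ψ hψ, sub_self]
  filter_upwards [(ae_restrict_iff' hΩ.measurableSet).2 hzero] with x hx
  exact sub_eq_zero.1 hx

lemma IsWeakGradient.unique (hΩ : IsOpen Ω) {u : Vec d → Vec d} {G H : Vec d → Tensor d}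
    (hG : IsWeakGradient Ω u G) (hH : IsWeakGradient Ω u H) : G =ᵐ[volume.restrict Ω] H :=
  ae_eq_of_entries fun i j =>
    ae_eq_of_forall_integral_mul_test_eq hΩ (hG.1 i j) (hH.1 i j) fun ψ hψ =>
      neg_injective ((hG.2 ψ hψ i j).symm.trans (hH.2 ψ hψ i j))

lemma IsWeakGradient.isWeakGradient_weakGradient {u : Vec d → Vec d} {G : Vec d → Tensor d}
    (hG : IsWeakGradient Ω u G) : IsWeakGradient Ω u (weakGradient Ω u) := by
  have h : ∃ G, IsWeakGradient Ω u G := ⟨G, hG⟩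
  rw [weakGradient, dif_pos h]
  exact h.choose_spec

lemma IsWeakGradient.weakGradient_ae_eq (hΩ : IsOpen Ω) {u : Vec d → Vec d} {G : Vec d → Tensor d}
    (hG : IsWeakGradient Ω u G) : weakGradient Ω u =ᵐ[volume.restrict Ω] G :=
  hG.isWeakGradient_weakGradient.unique hΩ hG

lemma weakGradient_ae_eq (hΩ : IsOpen Ω) {z : L2 Ω × TensorL2 Ω} (hz : z ∈ sobolevGraph Ω) :
    weakGradient Ω z.1 =ᵐ[volume.restrict Ω] tensorField z.2 :=
  (isWeakGradient_tensorField hz).weakGradient_ae_eq hΩ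

/-- The trace of a square-integrable tensor field, which is the divergence on `sobolevGraph Ω`. -/
def traceL2 (Ω : Set (Vec d)) : L2 Ω × TensorL2 Ω →L[ℝ] Lp ℝ 2 (volume.restrict Ω) :=
  ∑ i, (ContinuousLinearMap.proj i).comp ((ContinuousLinearMap.proj i).comp
    (ContinuousLinearMap.snd ℝ (L2 Ω) (TensorL2 Ω)))

/-- The graph of the weak gradient on the divergence-free fields, see `mem_admissible_iff`. -/
def solenoidalGraph (Ω : Set (Vec d)) : Submodule ℝ (L2 Ω × TensorL2 Ω) :=
  sobolevGraph Ω ⊓ (traceL2 Ω).ker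

lemma isClosed_solenoidalGraph : IsClosed (solenoidalGraph Ω : Set (L2 Ω × TensorL2 Ω)) :=
  (Submodule.isClosed_topologicalClosure _).inter (ContinuousLinearMap.isClosed_ker _)

lemma traceL2_ae_eq (z : L2 Ω × TensorL2 Ω) :
    traceL2 Ω z =ᵐ[volume.restrict Ω] fun x => (tensorField z.2 x).trace := by
  have hsum : traceL2 Ω z = ∑ i, z.2 i i := by simp [traceL2]
  rw [hsum]
  filter_upwards [Lp.coeFn_finsetSum Finset.univ (fun i => z.2 i i)] with x hx
  rw [hx, Finset.sum_apply]
  rfl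

lemma traceL2_eq_zero_iff (hΩ : IsOpen Ω) {z : L2 Ω × TensorL2 Ω} (hz : z ∈ sobolevGraph Ω) :
    traceL2 Ω z = 0 ↔ ∀ᵐ x ∂(volume.restrict Ω), divergence Ω z.1 x = 0 := by
  have hdiv : divergence Ω z.1 =ᵐ[volume.restrict Ω] traceL2 Ω z := by
    filter_upwards [weakGradient_ae_eq hΩ hz, traceL2_ae_eq z] with x hgrad htrace
    rw [divergence, hgrad, htrace]
  rw [Lp.eq_zero_iff_ae_eq_zero]
  exact ⟨hdiv.trans, hdiv.symm.trans⟩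

lemma mem_admissible_iff (hΩ : IsOpen Ω) {u : L2 Ω} :
    u ∈ Admissible Ω ↔ ∃ g, (u, g) ∈ solenoidalGraph Ω := by
  constructor
  · rintro ⟨hu, hdiv⟩
    obtain ⟨g, hg⟩ := mem_H10_iff.1 hu
    exact ⟨g, hg, (traceL2_eq_zero_iff hΩ hg).2 hdiv⟩
  · rintro ⟨g, hg, htrace⟩
    exact ⟨mem_H10_iff.2 ⟨g, hg⟩, (traceL2_eq_zero_iff hΩ hg).1 htrace⟩

end SobolevGraph

/-! ### Korn's inequality -/

section TensorFields

variable {d : ℕ} {α : Type*} [MeasurableSpace α] {ν : Measure α} {A B : α → Tensor d}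

lemma integrable_contract (hA : ∀ i j, MemLp (fun x => A x i j) 2 ν)
    (hB : ∀ i j, MemLp (fun x => B x i j) 2 ν) : Integrable (fun x => contract (A x) (B x)) ν :=
  integrable_finsetSum _ fun i _ => integrable_finsetSum _ fun j _ =>
    (hA i j).integrable_mul (hB i j)

lemma integral_contract (hA : ∀ i j, MemLp (fun x => A x i j) 2 ν)
    (hB : ∀ i j, MemLp (fun x => B x i j) 2 ν) :
    ∫ x, contract (A x) (B x) ∂ν = ∑ i, ∑ j, ∫ x, A x i j * B x i j ∂ν := by
  have hAB : ∀ i j, Integrable (fun x => A x i j * B x i j) ν :=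
    fun i j => (hA i j).integrable_mul (hB i j)
  simp only [contract]
  rw [integral_finsetSum _ fun i _ => integrable_finsetSum _ fun j _ => hAB i j]
  exact Finset.sum_congr rfl fun i _ => integral_finsetSum _ fun j _ => hAB i j

lemma memLp_symPart (hA : ∀ i j, MemLp (fun x => A x i j) 2 ν) (i j : Fin d) :
    MemLp (fun x => symPart (A x) i j) 2 ν := by
  simp only [symPart_apply]
  exact ((hA i j).add (hA j i)).const_mul _

lemma memLp_tensorInv (hA : ∀ i j, MemLp (fun x => A x i j) 2 ν) :
    MemLp (fun x => tensorInv (A x)) 2 ν := by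
  have hcontract := integrable_contract hA hA
  rw [memLp_two_iff_integrable_sq]
  · simpa only [contract_self_eq, mul_div_cancel_left₀ _ (two_ne_zero' ℝ)]
      using hcontract.div_const 2
  · exact Real.continuous_sqrt.comp_aestronglyMeasurable
      (hcontract.aestronglyMeasurable.const_mul (1 / 2))

end TensorFields

section Korn

variable {d : ℕ} {Ω : Set (Vec d)}

/-- The square of the norm of the symmetric part of a matrix with entries in a normed space; for
the gradient of a velocity field this is the squared `L²` norm of the strain rate. -/
def strainNormSq {H : Type*} [NormedAddCommGroup H] [NormedSpace ℝ H] (g : Fin d → Fin d → H) :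
    ℝ :=
  ∑ i, ∑ j, ‖(1 / 2 : ℝ) • (g i j + g j i)‖ ^ 2

lemma continuous_strainNormSq {H : Type*} [NormedAddCommGroup H] [NormedSpace ℝ H] :
    Continuous (strainNormSq : (Fin d → Fin d → H) → ℝ) := by
  unfold strainNormSq
  fun_prop

lemma strainNormSq_eq_of_inner_swap {H : Type*} [NormedAddCommGroup H] [InnerProductSpace ℝ H]
    {g : Fin d → Fin d → H} (hg : ∀ i j, inner ℝ (g i j) (g j i) = inner ℝ (g i i) (g j j)) :
    strainNormSq g = 1 / 2 * ∑ i, ∑ j, ‖g i j‖ ^ 2 + 1 / 2 * ‖∑ i, g i i‖ ^ 2 := by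
  have hexpand : ∀ i j, ‖(1 / 2 : ℝ) • (g i j + g j i)‖ ^ 2
      = 1 / 4 * ‖g i j‖ ^ 2 + 1 / 4 * ‖g j i‖ ^ 2 + 1 / 2 * inner ℝ (g i j) (g j i) := by
    intro i j
    rw [norm_smul, mul_pow, norm_add_sq_real, Real.norm_of_nonneg (by norm_num)]
    ring
  have htranspose : ∑ i, ∑ j, ‖g j i‖ ^ 2 = ∑ i, ∑ j, ‖g i j‖ ^ 2 := Finset.sum_comm
  have htrace : ∑ i, ∑ j, inner ℝ (g i j) (g j i) = ‖∑ i, g i i‖ ^ 2 := by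
    simp only [hg, ← real_inner_self_eq_norm_sq, sum_inner, inner_sum]
    exact Finset.sum_comm
  simp only [strainNormSq, hexpand, Finset.sum_add_distrib, ← Finset.mul_sum]
  rw [htranspose, htrace]
  ring

lemma inner_eq_integral_mul (a b : Lp ℝ 2 (volume.restrict Ω)) :
    inner ℝ a b = ∫ x in Ω, a x * b x := by
  rw [L2.inner_def]
  exact integral_congr_ae (Eventually.of_forall fun x => mul_comm _ _)

/-- Two integrations by parts exchange the derivatives in `∫ ∂ⱼwᵢ ∂ᵢwⱼ`. -/
lemma strainNormSq_eq_of_mem_testGraph {z : L2 Ω × TensorL2 Ω} (hz : z ∈ testGraph Ω) :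
    strainNormSq z.2 = 1 / 2 * ∑ i, ∑ j, ‖z.2 i j‖ ^ 2 + 1 / 2 * ‖∑ i, z.2 i i‖ ^ 2 := by
  obtain ⟨w, hw, -, hgrad⟩ := hz
  have hinner : ∀ i j k l, inner ℝ (z.2 i j) (z.2 k l)
      = ∫ x in Ω, partialDeriv j (fun y => w y i) x * partialDeriv l (fun y => w y k) x := by
    intro i j k l
    rw [inner_eq_integral_mul]
    refine integral_congr_ae (hgrad.mono fun x hx => ?_)
    simp only [partialDeriv_coord (hw.differentiable x), ← classicalGradient_apply, ← hx]
    rfl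
  refine strainNormSq_eq_of_inner_swap fun i j => ?_
  rw [hinner, hinner]
  exact (hw.coord i).integral_partialDeriv_mul_comm (hw.coord j) i j

lemma korn {z : L2 Ω × TensorL2 Ω} (hz : z ∈ sobolevGraph Ω) :
    ∑ i, ∑ j, ‖z.2 i j‖ ^ 2 ≤ 2 * strainNormSq z.2 := by
  refine sobolevGraph_induction (P := fun z => ∑ i, ∑ j, ‖z.2 i j‖ ^ 2 ≤ 2 * strainNormSq z.2)
    (isClosed_le (by fun_prop)
      (continuous_const.mul (continuous_strainNormSq.comp continuous_snd))) (fun z hz => ?_) hz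
  rw [strainNormSq_eq_of_mem_testGraph hz]
  nlinarith [sq_nonneg ‖∑ i, z.2 i i‖]

lemma norm_sq_eq_sum_integral (u : L2 Ω) : ‖u‖ ^ 2 = ∑ i, ∫ x in Ω, u x i * u x i := by
  rw [← real_inner_self_eq_norm_sq, L2.inner_def, ← integral_finsetSum]
  · simp only [PiLp.inner_apply, RCLike.inner_apply, conj_trivial]
  · intro i _
    exact ((Lp.memLp u).eval_piLp i).integrable_mul ((Lp.memLp u).eval_piLp i)

lemma poincare (hΩ : MeasurableSet Ω) (j : Fin d) {R : ℝ} (hR : ∀ x ∈ Ω, |x j| ≤ R)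
    {z : L2 Ω × TensorL2 Ω} (hz : z ∈ sobolevGraph Ω) :
    ‖z.1‖ ^ 2 ≤ 4 * R ^ 2 * ∑ i, ‖z.2 i j‖ ^ 2 := by
  refine sobolevGraph_induction (P := fun z => ‖z.1‖ ^ 2 ≤ 4 * R ^ 2 * ∑ i, ‖z.2 i j‖ ^ 2)
    (isClosed_le (by fun_prop) (by fun_prop)) ?_ hz
  rintro z ⟨w, hw, hz, hgrad⟩
  rw [norm_sq_eq_sum_integral, Finset.mul_sum]
  refine Finset.sum_le_sum fun i _ => ?_
  have hvalue : ∫ x in Ω, z.1 x i * z.1 x i = ∫ x in Ω, w x i * w x i :=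
    integral_congr_ae (hz.mono fun x hx => by simp only [hx])
  have hderiv : ‖z.2 i j‖ ^ 2
      = ∫ x in Ω, partialDeriv j (fun y => w y i) x * partialDeriv j (fun y => w y i) x := by
    rw [← real_inner_self_eq_norm_sq, inner_eq_integral_mul]
    refine integral_congr_ae (hgrad.mono fun x hx => ?_)
    simp only [partialDeriv_coord (hw.differentiable x), ← classicalGradient_apply, ← hx]
    rfl
  rw [hvalue, hderiv]
  exact (hw.coord i).poincare hΩ j hR

lemma norm_sq_le_sum_norm_sq {H : Type*} [NormedAddCommGroup H] (g : Fin d → Fin d → H) :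
    ‖g‖ ^ 2 ≤ ∑ i, ∑ j, ‖g i j‖ ^ 2 := by
  have hnonneg : 0 ≤ ∑ i, ∑ j, ‖g i j‖ ^ 2 := by positivity
  refine (Real.le_sqrt (norm_nonneg _) hnonneg).1 ?_
  refine (pi_norm_le_iff_of_nonneg (Real.sqrt_nonneg _)).2 fun i =>
    (pi_norm_le_iff_of_nonneg (Real.sqrt_nonneg _)).2 fun j => Real.le_sqrt_of_sq_le ?_
  calc ‖g i j‖ ^ 2 ≤ ∑ j, ‖g i j‖ ^ 2 :=
        Finset.single_le_sum (f := fun j => ‖g i j‖ ^ 2) (fun _ _ => sq_nonneg _)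
          (Finset.mem_univ j)
    _ ≤ ∑ i, ∑ j, ‖g i j‖ ^ 2 :=
        Finset.single_le_sum (f := fun i => ∑ j, ‖g i j‖ ^ 2) (fun _ _ => by positivity)
          (Finset.mem_univ i)

lemma exists_norm_sq_le_strainNormSq (hΩ : MeasurableSet Ω) (hb : Bornology.IsBounded Ω)
    (hd : 0 < d) : ∃ c > 0, ∀ z ∈ sobolevGraph Ω, c * ‖z‖ ^ 2 ≤ strainNormSq z.2 := by
  obtain ⟨R, hR⟩ := hb.exists_norm_le
  have hcoord : ∀ x ∈ Ω, |x ⟨0, hd⟩| ≤ R := fun x hx =>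
    (PiLp.norm_apply_le x (⟨0, hd⟩ : Fin d)).trans (hR x hx)
  refine ⟨1 / (2 + 8 * R ^ 2), by positivity, fun z hz => ?_⟩
  have hkorn := korn hz
  have hgrad := norm_sq_le_sum_norm_sq z.2
  set S := ∑ i, ∑ j, ‖z.2 i j‖ ^ 2
  have hvalue : ‖z.1‖ ^ 2 ≤ 4 * R ^ 2 * S := by
    refine (poincare hΩ _ hcoord hz).trans (mul_le_mul_of_nonneg_left ?_ (by positivity))
    exact Finset.sum_le_sum fun i _ => Finset.single_le_sum (f := fun j => ‖z.2 i j‖ ^ 2)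
      (fun _ _ => sq_nonneg _) (Finset.mem_univ _)
  have hgraph : ‖z‖ ^ 2 ≤ (1 + 4 * R ^ 2) * S := by
    rw [Prod.norm_def]
    rcases max_choice ‖z.1‖ ‖z.2‖ with h | h <;> rw [h] <;>
      nlinarith [sq_nonneg ‖z.1‖, sq_nonneg ‖z.2‖, sq_nonneg R]
  rw [one_div, inv_mul_le_iff₀ (by positivity)]
  nlinarith [mul_le_mul_of_nonneg_left hkorn (show 0 ≤ 1 + 4 * R ^ 2 by positivity)]

lemma strainNormSq_eq_integral (g : TensorL2 Ω) :
    strainNormSq g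
      = ∫ x in Ω, contract (symPart (tensorField g x)) (symPart (tensorField g x)) := by
  have hg := memLp_symPart (A := tensorField g) fun i j => Lp.memLp (g i j)
  rw [integral_contract hg hg]
  refine Finset.sum_congr rfl fun i _ => Finset.sum_congr rfl fun j _ => ?_
  rw [← real_inner_self_eq_norm_sq, inner_eq_integral_mul]
  refine integral_congr_ae ?_
  filter_upwards [Lp.coeFn_smul (1 / 2 : ℝ) (g i j + g j i), Lp.coeFn_add (g i j) (g j i)]
    with x hsmul hadd
  rw [hsmul, Pi.smul_apply, hadd, symPart_apply]
  rfl

end Korn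

/-! ### Strain rates of weakly differentiable fields -/

section StrainRate

variable {d : ℕ} {Ω : Set (Vec d)}

lemma strainRate_ae_eq (hΩ : IsOpen Ω) {z : L2 Ω × TensorL2 Ω} (hz : z ∈ sobolevGraph Ω) :
    strainRate Ω z.1 =ᵐ[volume.restrict Ω] fun x => symPart (tensorField z.2 x) := by
  filter_upwards [weakGradient_ae_eq hΩ hz] with x hx
  rw [strainRate_eq_symPart, hx]

lemma smul_add_smul_mem_H10 {u v : L2 Ω} (hu : u ∈ H10 Ω) (hv : v ∈ H10 Ω) (a b : ℝ) :
    a • u + b • v ∈ H10 Ω := by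
  obtain ⟨g, hg⟩ := mem_H10_iff.1 hu
  obtain ⟨h, hh⟩ := mem_H10_iff.1 hv
  exact mem_H10_iff.2 ⟨a • g + b • h,
    (sobolevGraph Ω).add_mem ((sobolevGraph Ω).smul_mem a hg) ((sobolevGraph Ω).smul_mem b hh)⟩

lemma smul_add_smul_mem_admissible (hΩ : IsOpen Ω) {u v : L2 Ω} (hu : u ∈ Admissible Ω)
    (hv : v ∈ Admissible Ω) (a b : ℝ) : a • u + b • v ∈ Admissible Ω := by
  obtain ⟨g, hg⟩ := (mem_admissible_iff hΩ).1 hu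
  obtain ⟨h, hh⟩ := (mem_admissible_iff hΩ).1 hv
  exact (mem_admissible_iff hΩ).2 ⟨a • g + b • h, (solenoidalGraph Ω).add_mem
    ((solenoidalGraph Ω).smul_mem a hg) ((solenoidalGraph Ω).smul_mem b hh)⟩

lemma convex_admissible (hΩ : IsOpen Ω) : Convex ℝ (Admissible Ω) :=
  fun _ hu _ hv a b _ _ _ => smul_add_smul_mem_admissible hΩ hu hv a b

lemma sub_mem_H10 {u v : L2 Ω} (hu : u ∈ H10 Ω) (hv : v ∈ H10 Ω) : u - v ∈ H10 Ω := by
  simpa [sub_eq_add_neg] using smul_add_smul_mem_H10 hu hv 1 (-1)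

lemma sub_mem_admissible (hΩ : IsOpen Ω) {u v : L2 Ω} (hu : u ∈ Admissible Ω)
    (hv : v ∈ Admissible Ω) : u - v ∈ Admissible Ω := by
  simpa [sub_eq_add_neg] using smul_add_smul_mem_admissible hΩ hu hv 1 (-1)

lemma strainRate_smul_add_smul (hΩ : IsOpen Ω) {u v : L2 Ω} (hu : u ∈ H10 Ω) (hv : v ∈ H10 Ω)
    (a b : ℝ) : strainRate Ω ↑(a • u + b • v)
      =ᵐ[volume.restrict Ω] fun x => a • strainRate Ω u x + b • strainRate Ω v x := by
  obtain ⟨g, hg⟩ := mem_H10_iff.1 hu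
  obtain ⟨h, hh⟩ := mem_H10_iff.1 hv
  have hgh : (a • u + b • v, a • g + b • h) ∈ sobolevGraph Ω :=
    (sobolevGraph Ω).add_mem ((sobolevGraph Ω).smul_mem a hg) ((sobolevGraph Ω).smul_mem b hh)
  filter_upwards [strainRate_ae_eq hΩ hg, strainRate_ae_eq hΩ hh, strainRate_ae_eq hΩ hgh,
    tensorField_add (a • g) (b • h), tensorField_smul a g, tensorField_smul b h]
    with x hux hvx huvx hadd hsmul hsmul'
  rw [hux, hvx, huvx, hadd, hsmul, hsmul', map_add, map_smul, map_smul]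

lemma strainRate_sub (hΩ : IsOpen Ω) {u v : L2 Ω} (hu : u ∈ H10 Ω) (hv : v ∈ H10 Ω) :
    strainRate Ω ↑(u - v)
      =ᵐ[volume.restrict Ω] fun x => strainRate Ω u x - strainRate Ω v x := by
  simpa [sub_eq_add_neg] using strainRate_smul_add_smul hΩ hu hv 1 (-1)

lemma eq_of_strainRate_ae_eq (hΩ : IsOpen Ω) (hb : Bornology.IsBounded Ω) (hd : 0 < d)
    {u v : L2 Ω} (hu : u ∈ H10 Ω) (hv : v ∈ H10 Ω)
    (h : strainRate Ω u =ᵐ[volume.restrict Ω] strainRate Ω v) : u = v := by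
  obtain ⟨c, hc, hcoercive⟩ := exists_norm_sq_le_strainNormSq hΩ.measurableSet hb hd
  obtain ⟨g, hg⟩ := mem_H10_iff.1 (sub_mem_H10 hu hv)
  have hstrain : strainNormSq g = 0 := by
    rw [strainNormSq_eq_integral]
    refine integral_eq_zero_of_ae ?_
    filter_upwards [h, strainRate_sub hΩ hu hv, strainRate_ae_eq hΩ hg] with x hx hsub hsym
    rw [← hsym, hsub, hx, sub_self]
    simp [contract]
  have hnorm : ‖((u - v, g) : L2 Ω × TensorL2 Ω)‖ ^ 2 ≤ 0 := by
    have := hcoercive _ hg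
    rw [hstrain] at this
    exact nonpos_of_mul_nonpos_right this hc
  have hzero : ((u - v, g) : L2 Ω × TensorL2 Ω) = 0 :=
    norm_eq_zero.1 (sq_eq_zero_iff.1 (le_antisymm hnorm (sq_nonneg _)))
  exact sub_eq_zero.1 (congrArg Prod.fst hzero)

lemma memLp_strainRate {u : L2 Ω} (hu : u ∈ H10 Ω) (i j : Fin d) :
    MemLp (fun x => strainRate Ω u x i j) 2 (volume.restrict Ω) := by
  obtain ⟨G, hG, -⟩ := hu
  simp only [strainRate_eq_symPart]
  exact memLp_symPart hG.isWeakGradient_weakGradient.1 i j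

lemma memLp_secondInv {u : L2 Ω} (hu : u ∈ H10 Ω) :
    MemLp (fun x => secondInv Ω u x) 2 (volume.restrict Ω) :=
  memLp_tensorInv (memLp_strainRate hu)

lemma integral_inner_eq {f : Vec d → Vec d} (hf : MemLp f 2 (volume.restrict Ω)) (u : L2 Ω) :
    ∫ x in Ω, inner ℝ (f x) (u x) = inner ℝ hf.toLp u := by
  rw [L2.inner_def]
  refine integral_congr_ae ?_
  filter_upwards [hf.coeFn_toLp] with x hx
  rw [hx]

end StrainRate

/-! ### Convexity of the energy and uniqueness of solutions -/

section ConvexDensity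

variable {d : ℕ} {φ μ : ℝ → ℝ}

/-- Contraction with a fixed tensor, as a linear functional. -/
def contractLinear (A : Tensor d) : Tensor d →ₗ[ℝ] ℝ where
  toFun := contract A
  map_add' := contract_add_right A
  map_smul' c B := contract_smul_right c A B

lemma IsPotential.convexOn (h : IsPotential φ μ) :
    ConvexOn ℝ Set.univ fun A : Tensor d => φ (tensorInv A) :=
  convexOn_of_subgradient convex_univ fun A _ =>
    ⟨contractLinear (stress μ A), fun B _ => h.stress_subgradient A B⟩

lemma IsStrictPotential.strictConvexOn (h : IsStrictPotential φ μ) :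
    StrictConvexOn ℝ Set.univ fun A : Tensor d => φ (tensorInv A) :=
  strictConvexOn_of_subgradient convex_univ fun A _ =>
    ⟨contractLinear (stress μ A), fun _ _ hAB => h.stress_subgradient hAB⟩

end ConvexDensity

section Uniqueness

variable {d : ℕ} {Ω : Set (Vec d)} {φ μ : Vec d → ℝ → ℝ} {m : ℝ} {f : Vec d → Vec d}

lemma EnergyFinite.integrableOn_density {u : L2 Ω} (hu : EnergyFinite Ω φ f u) (m : ℝ) :
    IntegrableOn (fun x => φ x (secondInv Ω u x) + 2 * m * secondInv Ω u x ^ 2) Ω :=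
  hu.1.add (hu.2.1.const_mul (2 * m))

lemma energy_eq (hf : MemLp f 2 (volume.restrict Ω)) {u : L2 Ω} (hu : EnergyFinite Ω φ f u) :
    energy Ω φ m f u
      = (∫ x in Ω, (φ x (secondInv Ω u x) + 2 * m * secondInv Ω u x ^ 2))
        - innerₛₗ ℝ hf.toLp u := by
  rw [energy, integral_inner_eq hf, ← integral_const_mul,
    ← integral_add hu.1 (hu.2.1.const_mul _)]
  rfl

lemma convexOn_energy (hΩ : IsOpen Ω) (hf : MemLp f 2 (volume.restrict Ω))
    (hfin : ∀ u ∈ Admissible Ω, EnergyFinite Ω φ f u)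
    (h : ∀ᵐ x ∂volume.restrict Ω, IsPotential (fun s => φ x s + 2 * m * s ^ 2) (μ x)) :
    ConvexOn ℝ (Admissible Ω) (energy Ω φ m f) := by
  have hdensity := convexOn_integral_comp (T := fun u : L2 Ω => strainRate Ω u)
    (Ψ := fun x A => φ x (tensorInv A) + 2 * m * tensorInv A ^ 2) (convex_admissible hΩ)
    (fun u hu v hv => strainRate_smul_add_smul hΩ hu.1 hv.1)
    (fun u hu => (hfin u hu).integrableOn_density m)
    (h.mono fun x hx => hx.convexOn)
  exact (hdensity.sub ((innerₛₗ ℝ hf.toLp).concaveOn (convex_admissible hΩ))).congr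
    fun u hu => (energy_eq hf (hfin u hu)).symm

lemma strictConvexOn_energy (hΩ : IsOpen Ω) (hb : Bornology.IsBounded Ω) (hd : 0 < d)
    (hf : MemLp f 2 (volume.restrict Ω)) (hfin : ∀ u ∈ Admissible Ω, EnergyFinite Ω φ f u)
    (h : ∀ᵐ x ∂volume.restrict Ω, IsStrictPotential (fun s => φ x s + 2 * m * s ^ 2) (μ x)) :
    StrictConvexOn ℝ (Admissible Ω) (energy Ω φ m f) := by
  have hdensity := strictConvexOn_integral_comp (T := fun u : L2 Ω => strainRate Ω u)
    (Ψ := fun x A => φ x (tensorInv A) + 2 * m * tensorInv A ^ 2) (convex_admissible hΩ)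
    (fun u hu v hv => strainRate_smul_add_smul hΩ hu.1 hv.1)
    (fun u hu v hv => eq_of_strainRate_ae_eq hΩ hb hd hu.1 hv.1)
    (fun u hu => (hfin u hu).integrableOn_density m)
    (h.mono fun x hx => hx.strictConvexOn)
  exact (hdensity.sub_concaveOn
    ((innerₛₗ ℝ hf.toLp).concaveOn (convex_admissible hΩ))).congr
    fun u hu => (energy_eq hf (hfin u hu)).symm

lemma IsVelocitySolution.unique (hΩ : IsOpen Ω) (hb : Bornology.IsBounded Ω) (hd : 0 < d)
    (h : ∀ᵐ x ∂volume.restrict Ω, IsStrictPotential (φ x) (μ x)) {u₁ u₂ : L2 Ω}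
    (h₁ : IsVelocitySolution Ω μ f u₁) (h₂ : IsVelocitySolution Ω μ f u₂) : u₁ = u₂ := by
  obtain ⟨hint₁, heq₁⟩ := h₁.2 _ (sub_mem_admissible hΩ h₁.1 h₂.1)
  obtain ⟨hint₂, heq₂⟩ := h₂.2 _ (sub_mem_admissible hΩ h₁.1 h₂.1)
  set dissipation : Vec d → ℝ := fun x =>
    viscousIntegrand Ω μ u₁ ↑(u₁ - u₂) x - viscousIntegrand Ω μ u₂ ↑(u₁ - u₂) x
  have hdiss : ∀ᵐ x ∂volume.restrict Ω, dissipation x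
      = contract (stress (μ x) (strainRate Ω u₁ x) - stress (μ x) (strainRate Ω u₂ x))
        (strainRate Ω u₁ x - strainRate Ω u₂ x) := by
    filter_upwards [strainRate_sub hΩ h₁.1.1 h₂.1.1] with x hsub
    rw [contract_sub_left, ← hsub, ← viscousIntegrand_eq_contract_stress,
      ← viscousIntegrand_eq_contract_stress]
  have hnonneg : 0 ≤ᵐ[volume.restrict Ω] dissipation := by
    filter_upwards [h, hdiss] with x hx hdx
    rw [hdx]
    by_cases hstrain : strainRate Ω u₁ x = strainRate Ω u₂ x
    · simp [hstrain, contract]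
    · exact (hx.stress_strictMono hstrain).le
  have hzero : dissipation =ᵐ[volume.restrict Ω] 0 := by
    rw [← integral_eq_zero_iff_of_nonneg_ae hnonneg (hint₁.sub hint₂),
      integral_sub hint₁ hint₂, heq₁, heq₂, sub_self]
  refine eq_of_strainRate_ae_eq hΩ hb hd h₁.1.1 h₂.1.1 ?_
  filter_upwards [h, hdiss, hzero] with x hx hdx h0
  by_contra hstrain
  exact (hx.stress_strictMono hstrain).ne' (hdx.symm.trans h0)

lemma IsStokesSolution.isVelocitySolution {u : L2 Ω} {p : Vec d → ℝ}
    (h : IsStokesSolution Ω μ f u p) : IsVelocitySolution Ω μ f u := by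
  refine ⟨h.1, fun v hv => ⟨(h.2.2 v hv.1).1, ?_⟩⟩
  have hpressure : ∫ x in Ω, p x * divergence Ω v x = 0 :=
    integral_eq_zero_of_ae (hv.2.mono fun x hx => mul_eq_zero_of_right _ hx)
  rw [← (h.2.2 v hv.1).2, hpressure, sub_zero]

end Uniqueness

/-! ### Viscosity laws with a yield stress -/

section YieldLaw

/-- A viscosity law `μ`, varying from point to point, with potential `φ`, whose stress
`2 μ(s) s` is bounded by `τ`. Measurability in the space variable is encoded by stability under
substitution of measurable functions. -/
structure IsYieldLaw {α : Type*} [MeasurableSpace α] (ν : Measure α) (φ μ : α → ℝ → ℝ)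
    (τ : α → ℝ) : Prop where
  isPotential : ∀ᵐ x ∂ν, IsPotential (φ x) (μ x)
  stress_le : ∀ᵐ x ∂ν, ∀ ⦃s⦄, 0 ≤ s → 2 * μ x s * s ≤ τ x
  continuousOn : ∀ᵐ x ∂ν, ContinuousOn (μ x) (Set.Ici 0)
  aemeasurable_viscosity : ∀ ⦃s : α → ℝ⦄, AEMeasurable s ν → AEMeasurable (fun x => μ x (s x)) ν
  aemeasurable_density : ∀ ⦃s : α → ℝ⦄, AEMeasurable s ν → AEMeasurable (fun x => φ x (s x)) ν

variable {α : Type*} [MeasurableSpace α] {ν : Measure α} {μr τy : α → ℝ}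

lemma isYieldLaw_ideal (hμr : AEMeasurable μr ν) (hτy : AEMeasurable τy ν)
    (hpos : ∀ᵐ x ∂ν, 0 < μr x ∧ 0 < τy x) :
    IsYieldLaw ν (fun x s => phiIdeal (μr x) (τy x) s) (fun x s => viscIdeal 0 (μr x) (τy x) s)
      τy where
  isPotential := hpos.mono fun _ hx => isPotential_phiIdeal hx.1 hx.2
  stress_le := hpos.mono fun _ hx _ hs =>
    (two_mul_viscIdeal_zero_mul hx.1 hx.2 hs).trans_le (min_le_left _ _)
  continuousOn := hpos.mono fun _ hx => continuousOn_viscIdeal_zero hx.1 hx.2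
  aemeasurable_viscosity s hs := by
    have : Measurable fun p : ℝ × ℝ × ℝ => viscIdeal 0 p.1 p.2.1 p.2.2 :=
      measurable_const.add (Measurable.ite (measurableSet_eq_fun (by fun_prop) (by fun_prop))
        (by fun_prop) (by fun_prop))
    exact this.comp_aemeasurable (hμr.prodMk (hτy.prodMk hs))
  aemeasurable_density s hs := by
    have : Measurable fun p : ℝ × ℝ × ℝ => phiIdeal p.1 p.2.1 p.2.2 :=
      Measurable.ite (measurableSet_le (by fun_prop) (by fun_prop)) (by fun_prop) (by fun_prop)
    exact this.comp_aemeasurable (hμr.prodMk (hτy.prodMk hs))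

lemma isYieldLaw_composite (hμr : AEMeasurable μr ν) (hτy : AEMeasurable τy ν)
    (hpos : ∀ᵐ x ∂ν, 0 < μr x ∧ 0 < τy x) :
    IsYieldLaw ν (fun x s => phiComposite (μr x) (τy x) s)
      (fun x s => viscComposite (μr x) (τy x) s) τy where
  isPotential := hpos.mono fun _ hx => (isStrictPotential_phiComposite hx.1 hx.2).isPotential
  stress_le := hpos.mono fun _ hx _ hs => two_mul_viscComposite_mul_le hx.1 hx.2 hs
  continuousOn := hpos.mono fun x hx => by
    unfold viscComposite
    refine continuousOn_const.div (by fun_prop) fun s (hs : 0 ≤ s) => ?_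
    have := mul_nonneg (mul_nonneg zero_le_two hs) hx.1.le
    exact (add_pos_of_nonneg_of_pos this hx.2).ne'
  aemeasurable_viscosity s hs := by
    unfold viscComposite
    fun_prop
  aemeasurable_density s hs := by
    unfold phiComposite
    fun_prop

variable {φ μ : α → ℝ → ℝ} {τ : α → ℝ}

lemma IsYieldLaw.integrable_density_sub (h : IsYieldLaw ν φ μ τ) (hτ : MemLp τ 2 ν)
    {s : α → ℝ} (hs : MemLp s 2 ν) (hs0 : ∀ x, 0 ≤ s x) :
    Integrable (fun x => φ x (s x) - φ x 0) ν := by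
  refine ((hτ.integrable_mul hs).const_mul 2).mono' ?_ ?_
  · exact ((h.aemeasurable_density hs.aestronglyMeasurable.aemeasurable).sub
      (h.aemeasurable_density aemeasurable_const)).aestronglyMeasurable
  · filter_upwards [h.isPotential, h.stress_le] with x hφ hτx
    rw [Real.norm_of_nonneg (sub_nonneg.2 (hφ.le_of_nonneg (hs0 x)))]
    have := hφ.le_add_of_le (hs0 x) (hτx (hs0 x))
    simp only [Pi.mul_apply]
    linarith

lemma IsYieldLaw.energyFinite {d : ℕ} {Ω : Set (Vec d)} {φ μ : Vec d → ℝ → ℝ} {τ : Vec d → ℝ}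
    {f : Vec d → Vec d} (h : IsYieldLaw (volume.restrict Ω) φ μ τ)
    (hτ : MemLp τ 2 (volume.restrict Ω)) (hf : MemLp f 2 (volume.restrict Ω))
    (h0 : IntegrableOn (fun x => φ x 0) Ω) {u : L2 Ω} (hu : u ∈ H10 Ω) :
    EnergyFinite Ω φ f u := by
  refine ⟨?_, (memLp_secondInv hu).integrable_sq, ?_⟩
  · have := (h.integrable_density_sub hτ (memLp_secondInv hu) fun _ => tensorInv_nonneg _).add h0
    exact this.congr (Eventually.of_forall fun x => sub_add_cancel _ _)
  · refine (L2.integrable_inner (𝕜 := ℝ) hf.toLp u).congr ?_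
    filter_upwards [hf.coeFn_toLp] with x hx
    rw [hx]

end YieldLaw

/-! ### Existence of solutions -/

section StressFields

variable {d : ℕ}

lemma stress_const_add (m : ℝ) (μ : ℝ → ℝ) (A : Tensor d) :
    stress (fun s => m + μ s) A = (2 * m) • A + stress μ A := by
  rw [stress, stress, ← add_smul, mul_add]

lemma IsPotential.stress_subgradient_add_sq {φ μ : ℝ → ℝ} (h : IsPotential φ μ) (m : ℝ)
    (A B : Tensor d) :
    φ (tensorInv A) + 2 * m * tensorInv A ^ 2
        + contract (stress (fun s => m + μ s) A) (B - A) + m * contract (B - A) (B - A)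
      ≤ φ (tensorInv B) + 2 * m * tensorInv B ^ 2 := by
  have hsub := h.stress_subgradient A B
  have hquadratic : 2 * m * tensorInv A ^ 2 + 2 * m * contract A (B - A)
      + m * contract (B - A) (B - A) = 2 * m * tensorInv B ^ 2 := by
    simp only [contract_sub_left, contract_sub_right, contract_comm B A]
    rw [contract_self_eq, contract_self_eq]
    ring
  rw [stress_const_add, contract_add_left, contract_smul_left]
  linarith

lemma abs_contract_stress_le {μ : ℝ → ℝ} {τ : ℝ} (hμ : ∀ ⦃s⦄, 0 ≤ s → 0 ≤ μ s)
    (hτ : ∀ ⦃s⦄, 0 ≤ s → 2 * μ s * s ≤ τ) (A B : Tensor d) :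
    |contract (stress μ A) B| ≤ 2 * (τ * tensorInv B) := by
  have hA := tensorInv_nonneg A
  have hμA := hμ hA
  rw [stress, contract_smul_left, abs_mul, abs_of_nonneg (by positivity)]
  calc 2 * μ (tensorInv A) * |contract A B|
      ≤ 2 * μ (tensorInv A) * (2 * tensorInv A * tensorInv B) := by
        gcongr
        exact abs_contract_le A B
    _ = 2 * (2 * μ (tensorInv A) * tensorInv A * tensorInv B) := by ring
    _ ≤ 2 * (τ * tensorInv B) := by
        gcongr
        · exact tensorInv_nonneg B
        · exact hτ hA

lemma continuous_stress {μ : ℝ → ℝ} (hμ : ContinuousOn μ (Set.Ici 0)) :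
    Continuous (stress μ : Tensor d → Tensor d) :=
  (continuous_const.mul
    (hμ.comp_continuous continuous_tensorInv tensorInv_nonneg)).smul continuous_id

variable {α : Type*} [MeasurableSpace α] {ν : Measure α} {φ μ : α → ℝ → ℝ} {τ : α → ℝ} {m : ℝ}
  {A B : α → Tensor d}

lemma IsYieldLaw.memLp_stress (h : IsYieldLaw ν φ μ τ) (hτ : MemLp τ 2 ν)
    (hA : ∀ i j, MemLp (fun x => A x i j) 2 ν) (i j : Fin d) :
    MemLp (fun x => stress (μ x) (A x) i j) 2 ν := by
  have hmeas : AEMeasurable (fun x => μ x (tensorInv (A x))) ν :=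
    h.aemeasurable_viscosity (memLp_tensorInv hA).aestronglyMeasurable.aemeasurable
  refine (hτ.const_mul 2).mono ((hmeas.const_mul 2).mul
    (hA i j).aestronglyMeasurable.aemeasurable).aestronglyMeasurable ?_
  filter_upwards [h.isPotential, h.stress_le] with x hφ hτx
  have hinv := tensorInv_nonneg (A x)
  have hμ := hφ.nonneg hinv
  have hentry := mul_le_mul_of_nonneg_left (abs_entry_le (A x) i j) hμ
  refine le_trans ?_ (le_abs_self _)
  rw [stress, Matrix.smul_apply, smul_eq_mul, Real.norm_eq_abs, abs_mul,
    abs_of_nonneg (by positivity)]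
  linarith [hτx hinv]

lemma IsYieldLaw.memLp_stress_const_add (h : IsYieldLaw ν φ μ τ) (hτ : MemLp τ 2 ν)
    (hA : ∀ i j, MemLp (fun x => A x i j) 2 ν) (i j : Fin d) :
    MemLp (fun x => stress (fun s => m + μ x s) (A x) i j) 2 ν := by
  simp only [stress_const_add]
  exact ((hA i j).const_mul (2 * m)).add (h.memLp_stress hτ hA i j)

lemma IsYieldLaw.tendsto_integral_contract_stress (h : IsYieldLaw ν φ μ τ) (hτ : MemLp τ 2 ν)
    (hA : ∀ i j, MemLp (fun x => A x i j) 2 ν) (hB : ∀ i j, MemLp (fun x => B x i j) 2 ν) :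
    Tendsto (fun t : ℝ => ∫ x, contract (stress (μ x) (A x + t • B x)) (B x) ∂ν) (𝓝 0)
      (𝓝 (∫ x, contract (stress (μ x) (A x)) (B x) ∂ν)) := by
  refine tendsto_integral_filter_of_dominated_convergence _ (Eventually.of_forall fun t => ?_)
    (Eventually.of_forall fun t => ?_) ((hτ.integrable_mul (memLp_tensorInv hB)).const_mul 2) ?_
  · exact (integrable_contract (h.memLp_stress hτ fun i j => (hA i j).add ((hB i j).const_mul t))
      hB).aestronglyMeasurable
  · filter_upwards [h.isPotential, h.stress_le] with x hφ hτx
    exact abs_contract_stress_le hφ.nonneg hτx _ _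
  · filter_upwards [h.continuousOn] with x hμ
    have hline : Continuous fun t : ℝ => contract (stress (μ x) (A x + t • B x)) (B x) :=
      continuous_contract.comp (((continuous_stress hμ).comp
        (continuous_const.add (continuous_id.smul continuous_const))).prodMk continuous_const)
    simpa using hline.tendsto 0

lemma IsYieldLaw.tendsto_integral_contract_stress_const_add (h : IsYieldLaw ν φ μ τ)
    (hτ : MemLp τ 2 ν) (hA : ∀ i j, MemLp (fun x => A x i j) 2 ν)
    (hB : ∀ i j, MemLp (fun x => B x i j) 2 ν) :
    Tendsto
      (fun t : ℝ => ∫ x, contract (stress (fun s => m + μ x s) (A x + t • B x)) (B x) ∂ν) (𝓝 0)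
      (𝓝 (∫ x, contract (stress (fun s => m + μ x s) (A x)) (B x) ∂ν)) := by
  have hAB : ∀ t : ℝ, ∀ i j, MemLp (fun x => (A x + t • B x) i j) 2 ν :=
    fun t i j => (hA i j).add ((hB i j).const_mul t)
  have hsplit : ∀ C : α → Tensor d, (∀ i j, MemLp (fun x => C x i j) 2 ν) →
      ∫ x, contract (stress (fun s => m + μ x s) (C x)) (B x) ∂ν
        = 2 * m * ∫ x, contract (C x) (B x) ∂ν
          + ∫ x, contract (stress (μ x) (C x)) (B x) ∂ν := by
    intro C hC
    simp only [stress_const_add, contract_add_left, contract_smul_left]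
    rw [integral_add ((integrable_contract hC hB).const_mul _)
      (integrable_contract (h.memLp_stress hτ hC) hB), integral_const_mul]
  have hlinear : ∀ t : ℝ, ∫ x, contract (A x + t • B x) (B x) ∂ν
      = (∫ x, contract (A x) (B x) ∂ν) + t * ∫ x, contract (B x) (B x) ∂ν := by
    intro t
    simp only [contract_add_left, contract_smul_left]
    rw [integral_add (integrable_contract hA hB) ((integrable_contract hB hB).const_mul _),
      integral_const_mul]
  simp only [hsplit _ (hAB _), hsplit _ hA, hlinear]
  refine Tendsto.add ?_ (h.tendsto_integral_contract_stress hτ hA hB)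
  have hline : Continuous fun t : ℝ => 2 * m * ((∫ x, contract (A x) (B x) ∂ν)
      + t * ∫ x, contract (B x) (B x) ∂ν) := by fun_prop
  simpa using hline.tendsto 0

/-- The energy density of the viscosity law `m + μ`, with `μ` of potential `φ`, normalized to
vanish at zero strain rate. -/
def normalizedDensity (φ : ℝ → ℝ) (m : ℝ) (A : Tensor d) : ℝ :=
  φ (tensorInv A) - φ 0 + 2 * m * tensorInv A ^ 2

lemma IsYieldLaw.integrable_normalizedDensity (h : IsYieldLaw ν φ μ τ) (hτ : MemLp τ 2 ν)
    (hA : ∀ i j, MemLp (fun x => A x i j) 2 ν) :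
    Integrable (fun x => normalizedDensity (φ x) m (A x)) ν :=
  (h.integrable_density_sub hτ (memLp_tensorInv hA) fun _ => tensorInv_nonneg _).add
    ((memLp_tensorInv hA).integrable_sq.const_mul _)

lemma IsYieldLaw.integral_subgradient (h : IsYieldLaw ν φ μ τ) (hτ : MemLp τ 2 ν)
    (hA : ∀ i j, MemLp (fun x => A x i j) 2 ν) (hB : ∀ i j, MemLp (fun x => B x i j) 2 ν) :
    (∫ x, normalizedDensity (φ x) m (A x) ∂ν)
        + (∫ x, contract (stress (fun s => m + μ x s) (A x)) (B x - A x) ∂ν)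
        + m * ∫ x, contract (B x - A x) (B x - A x) ∂ν
      ≤ ∫ x, normalizedDensity (φ x) m (B x) ∂ν := by
  have hsub : ∀ i j, MemLp (fun x => (B x - A x) i j) 2 ν := fun i j => (hB i j).sub (hA i j)
  have hdensity := h.integrable_normalizedDensity (m := m) hτ hA
  have hstress := integrable_contract (h.memLp_stress_const_add (m := m) hτ hA) hsub
  have hquadratic := (integrable_contract hsub hsub).const_mul m
  have hfirstOrder : Integrable (fun x => normalizedDensity (φ x) m (A x)
      + contract (stress (fun s => m + μ x s) (A x)) (B x - A x)) ν := hdensity.add hstress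
  rw [← integral_const_mul, ← integral_add hdensity hstress,
    ← integral_add hfirstOrder hquadratic]
  refine integral_mono_ae (hfirstOrder.add hquadratic)
    (h.integrable_normalizedDensity hτ hB) ?_
  filter_upwards [h.isPotential] with x hx
  have := hx.stress_subgradient_add_sq m (A x) (B x)
  simp only [normalizedDensity]
  linarith

end StressFields

section Existence

variable {d : ℕ} {Ω : Set (Vec d)}

/-- The functional `(v, g) ↦ ∫ S : symPart g - ∫ f · v` given by a square-integrable stress field
`S` and force `f`. -/
def virtualWork {S : Vec d → Tensor d}
    (hS : ∀ i j, MemLp (fun x => S x i j) 2 (volume.restrict Ω)) {f : Vec d → Vec d}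
    (hf : MemLp f 2 (volume.restrict Ω)) : L2 Ω × TensorL2 Ω →L[ℝ] ℝ :=
  (∑ i, ∑ j, (innerSL ℝ (memLp_symPart hS i j).toLp).comp
      ((ContinuousLinearMap.proj j).comp ((ContinuousLinearMap.proj i).comp
        (ContinuousLinearMap.snd ℝ (L2 Ω) (TensorL2 Ω)))))
    - (innerSL ℝ hf.toLp).comp (ContinuousLinearMap.fst ℝ (L2 Ω) (TensorL2 Ω))

lemma virtualWork_apply {S : Vec d → Tensor d}
    (hS : ∀ i j, MemLp (fun x => S x i j) 2 (volume.restrict Ω)) {f : Vec d → Vec d}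
    (hf : MemLp f 2 (volume.restrict Ω)) (z : L2 Ω × TensorL2 Ω) :
    virtualWork hS hf z
      = (∫ x in Ω, contract (S x) (symPart (tensorField z.2 x))) - inner ℝ hf.toLp z.1 := by
  have hentry : ∀ i j, inner ℝ (memLp_symPart hS i j).toLp (z.2 i j)
      = ∫ x in Ω, symPart (S x) i j * tensorField z.2 x i j := by
    intro i j
    rw [inner_eq_integral_mul]
    refine integral_congr_ae ?_
    filter_upwards [(memLp_symPart hS i j).coeFn_toLp] with x hx
    rw [hx, tensorField_apply]
  simp only [contract_symPart_right]
  rw [integral_contract (memLp_symPart hS) (B := tensorField z.2) fun i j => Lp.memLp (z.2 i j)]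
  simp [virtualWork, hentry]

lemma memLp_symPart_tensorField (g : TensorL2 Ω) (i j : Fin d) :
    MemLp (fun x => symPart (tensorField g x) i j) 2 (volume.restrict Ω) :=
  memLp_symPart (A := tensorField g) (fun i j => Lp.memLp (g i j)) i j

lemma symPart_tensorField_add_smul (g h : TensorL2 Ω) (t : ℝ) :
    (fun x => symPart (tensorField (g + t • h) x)) =ᵐ[volume.restrict Ω]
      fun x => symPart (tensorField g x) + t • symPart (tensorField h x) := by
  filter_upwards [tensorField_add g (t • h), tensorField_smul t h] with x hadd hsmul
  rw [hadd, hsmul, map_add, map_smul]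

lemma symPart_tensorField_sub (g h : TensorL2 Ω) :
    (fun x => symPart (tensorField (g - h) x)) =ᵐ[volume.restrict Ω]
      fun x => symPart (tensorField g x) - symPart (tensorField h x) := by
  simpa [sub_eq_add_neg] using symPart_tensorField_add_smul g h (-1)

variable {φ μ : Vec d → ℝ → ℝ} {τ : Vec d → ℝ} {f : Vec d → Vec d} {m : ℝ}

/-- The energy of the viscosity law `m + μ` on the graph of the gradient, with the density
normalized to vanish at zero strain rate. It is finite even where `φ(0)` is not integrable. -/
def normalizedEnergy (φ : Vec d → ℝ → ℝ) (m : ℝ) (hf : MemLp f 2 (volume.restrict Ω))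
    (z : solenoidalGraph Ω) : ℝ :=
  (∫ x in Ω, normalizedDensity (φ x) m (symPart (tensorField z.1.2 x))) - inner ℝ hf.toLp z.1.1

/-- The derivative of `normalizedEnergy`. -/
def energyDerivative (h : IsYieldLaw (volume.restrict Ω) φ μ τ)
    (hτ : MemLp τ 2 (volume.restrict Ω)) (m : ℝ) (hf : MemLp f 2 (volume.restrict Ω))
    (z : solenoidalGraph Ω) : solenoidalGraph Ω →L[ℝ] ℝ :=
  (virtualWork (h.memLp_stress_const_add (m := m) hτ (memLp_symPart_tensorField z.1.2)) hf).comp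
    (solenoidalGraph Ω).subtypeL

lemma energyDerivative_apply (h : IsYieldLaw (volume.restrict Ω) φ μ τ)
    (hτ : MemLp τ 2 (volume.restrict Ω)) (hf : MemLp f 2 (volume.restrict Ω))
    (z v : solenoidalGraph Ω) :
    energyDerivative h hτ m hf z v
      = (∫ x in Ω, contract (stress (fun s => m + μ x s) (symPart (tensorField z.1.2 x)))
          (symPart (tensorField v.1.2 x))) - inner ℝ hf.toLp v.1.1 :=
  virtualWork_apply (h.memLp_stress_const_add hτ (memLp_symPart_tensorField z.1.2)) hf v.1

lemma hasStrongSubgradient_normalizedEnergy (h : IsYieldLaw (volume.restrict Ω) φ μ τ)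
    (hτ : MemLp τ 2 (volume.restrict Ω)) (hf : MemLp f 2 (volume.restrict Ω)) (hm : 0 ≤ m) {c : ℝ}
    (hcoercive : ∀ z ∈ sobolevGraph Ω, c * ‖z‖ ^ 2 ≤ strainNormSq z.2) :
    HasStrongSubgradient (normalizedEnergy φ m hf) (energyDerivative h hτ m hf) (m * c) := by
  intro y z
  have hsub := symPart_tensorField_sub z.1.2 y.1.2
  have hstress : ∫ x in Ω, contract (stress (fun s => m + μ x s) (symPart (tensorField y.1.2 x)))
        (symPart (tensorField (z.1.2 - y.1.2) x))
      = ∫ x in Ω, contract (stress (fun s => m + μ x s) (symPart (tensorField y.1.2 x)))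
        (symPart (tensorField z.1.2 x) - symPart (tensorField y.1.2 x)) :=
    integral_congr_ae (hsub.mono fun x hx => by simp only [hx])
  have hstrain : strainNormSq (z.1.2 - y.1.2)
      = ∫ x in Ω, contract (symPart (tensorField z.1.2 x) - symPart (tensorField y.1.2 x))
        (symPart (tensorField z.1.2 x) - symPart (tensorField y.1.2 x)) := by
    rw [strainNormSq_eq_integral]
    exact integral_congr_ae (hsub.mono fun x hx => by simp only [hx])
  have hconvex := h.integral_subgradient (m := m) hτ (memLp_symPart_tensorField y.1.2)
    (memLp_symPart_tensorField z.1.2)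
  rw [← hstress, ← hstrain] at hconvex
  have hkorn : m * (c * ‖z - y‖ ^ 2) ≤ m * strainNormSq (z.1.2 - y.1.2) :=
    mul_le_mul_of_nonneg_left (hcoercive (z - y).1 (z - y).2.1) hm
  have hforce : inner ℝ hf.toLp (z - y).1.1 = inner ℝ hf.toLp z.1.1 - inner ℝ hf.toLp y.1.1 :=
    inner_sub_right _ _ _
  rw [energyDerivative_apply, hforce, normalizedEnergy, normalizedEnergy]
  change _ + ((∫ x in Ω, contract _ (symPart (tensorField (z.1.2 - y.1.2) x))) - _) + _ ≤ _
  linarith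

lemma tendsto_energyDerivative (h : IsYieldLaw (volume.restrict Ω) φ μ τ)
    (hτ : MemLp τ 2 (volume.restrict Ω)) (hf : MemLp f 2 (volume.restrict Ω))
    (z v : solenoidalGraph Ω) :
    Tendsto (fun t : ℝ => energyDerivative h hτ m hf (z + t • v) v) (𝓝 0)
      (𝓝 (energyDerivative h hτ m hf z v)) := by
  simp only [energyDerivative_apply]
  refine Tendsto.sub_const ?_ _
  refine (h.tendsto_integral_contract_stress_const_add hτ (memLp_symPart_tensorField z.1.2)
    (memLp_symPart_tensorField v.1.2)).congr fun t => integral_congr_ae ?_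
  filter_upwards [symPart_tensorField_add_smul z.1.2 v.1.2 t] with x hx
  rw [← hx]
  rfl

theorem IsYieldLaw.exists_isVelocitySolution (h : IsYieldLaw (volume.restrict Ω) φ μ τ)
    (hΩ : IsOpen Ω) (hb : Bornology.IsBounded Ω) (hd : 0 < d)
    (hτ : MemLp τ 2 (volume.restrict Ω)) (hf : MemLp f 2 (volume.restrict Ω)) (hm : 0 < m) :
    ∃ u : L2 Ω, IsVelocitySolution Ω (fun x s => m + μ x s) f u := by
  obtain ⟨c, hc, hcoercive⟩ := exists_norm_sq_le_strainNormSq hΩ.measurableSet hb hd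
  have : CompleteSpace (solenoidalGraph Ω) := isClosed_solenoidalGraph.completeSpace_coe
  have hJ := hasStrongSubgradient_normalizedEnergy h hτ hf hm.le hcoercive
  obtain ⟨z, hz⟩ := hJ.exists_forall_le (mul_pos hm hc)
  have hcritical : energyDerivative h hτ m hf z = 0 :=
    hJ.eq_zero_of_forall_le (mul_pos hm hc) (fun y v =>
      (tendsto_energyDerivative h hτ hf y v).mono_left nhdsWithin_le_nhds) hz
  refine ⟨z.1.1, (mem_admissible_iff hΩ).2 ⟨z.1.2, z.2⟩, fun v hv => ?_⟩
  obtain ⟨g, hg⟩ := (mem_admissible_iff hΩ).1 hv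
  have hviscous : (fun x => contract (stress (fun s => m + μ x s) (symPart (tensorField z.1.2 x)))
      (symPart (tensorField g x)))
      =ᵐ[volume.restrict Ω] viscousIntegrand Ω (fun x s => m + μ x s) z.1.1 v := by
    filter_upwards [strainRate_ae_eq hΩ z.2.1, strainRate_ae_eq hΩ hg.1] with x hz hv
    rw [viscousIntegrand_eq_contract_stress, hz, hv]
  have hintegrable := integrable_contract
    (h.memLp_stress_const_add (m := m) hτ (memLp_symPart_tensorField z.1.2))
    (memLp_symPart_tensorField g)
  refine ⟨hintegrable.congr hviscous, ?_⟩
  rw [← integral_congr_ae hviscous, integral_inner_eq hf]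
  have hweak := energyDerivative_apply (m := m) h hτ hf z ⟨(v, g), hg⟩
  rw [hcritical, zero_apply] at hweak
  exact sub_eq_zero.1 hweak.symm

end Existence

theorem exists_isVelocitySolution_ideal {d : ℕ} {Ω : Set (Vec d)} {μr τy : Vec d → ℝ}
    {f : Vec d → Vec d} {m : ℝ} (hΩ : IsOpen Ω) (hb : Bornology.IsBounded Ω)
    (hd : 0 < d) (hm : 0 < m) (hμr : AEMeasurable μr (volume.restrict Ω))
    (hτy : MemLp τy 2 (volume.restrict Ω)) (hf : MemLp f 2 (volume.restrict Ω))
    (hpos : ∀ᵐ x ∂volume.restrict Ω, 0 < μr x ∧ 0 < τy x) :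
    ∃ u : L2 Ω, IsVelocitySolution Ω (fun x s => viscIdeal m (μr x) (τy x) s) f u := by
  simpa only [← viscIdeal_eq_add] using
    (isYieldLaw_ideal hμr hτy.aemeasurable hpos).exists_isVelocitySolution hΩ hb hd hτy hf hm

/-! ### Smooth solutions -/

section SmoothSolutions

variable {d : ℕ} {Ω : Set (Vec d)}

lemma IsTest.mem_H10 {w : Vec d → Vec d} (hw : IsTest Ω w) : (hw.memLp Ω 2).toLp ∈ H10 Ω := by
  have hentry := fun i j => (hw.gradient_entry i j).memLp Ω 2
  exact mem_H10_iff.2 ⟨fun i j => (hentry i j).toLp, subset_closure ⟨w, hw,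
    (hw.memLp Ω 2).coeFn_toLp, ae_eq_of_entries fun i j => (hentry i j).coeFn_toLp⟩⟩

lemma IsTest.weakGradient_ae_eq (hΩ : IsOpen Ω) {w : Vec d → Vec d} (hw : IsTest Ω w) :
    weakGradient Ω (hw.memLp Ω 2).toLp =ᵐ[volume.restrict Ω] classicalGradient w :=
  (hw.isWeakGradient.congr (hw.memLp Ω 2).coeFn_toLp.symm .rfl).weakGradient_ae_eq hΩ

lemma IsTest.mem_admissible (hΩ : IsOpen Ω) {w : Vec d → Vec d} (hw : IsTest Ω w)
    (htrace : ∀ x, (classicalGradient w x).trace = 0) : (hw.memLp Ω 2).toLp ∈ Admissible Ω := by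
  refine ⟨hw.mem_H10, ?_⟩
  filter_upwards [hw.weakGradient_ae_eq hΩ] with x hx
  rw [divergence, hx, htrace]

/-- The force `-div S` that balances a smooth stress field `S`. -/
def stressForce (S : Vec d → Tensor d) (x : Vec d) : Vec d :=
  WithLp.toLp 2 fun i => -∑ j, partialDeriv j (fun y => S y i j) x

lemma memLp_stressForce {S : Vec d → Tensor d} (hS : ∀ i j, IsTest Ω fun x => S x i j) :
    MemLp (stressForce S) 2 (volume.restrict Ω) :=
  MemLp.of_eval_piLp fun i =>
    (memLp_finsetSum _ fun j _ => ((hS i j).pderiv j).memLp Ω 2).neg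

lemma integral_contract_eq_integral_inner_stressForce {S : Vec d → Tensor d}
    (hS : ∀ i j, IsTest Ω fun x => S x i j) {v : Vec d → Vec d}
    (hv : MemLp v 2 (volume.restrict Ω)) {G : Vec d → Tensor d} (hG : IsWeakGradient Ω v G) :
    ∫ x in Ω, contract (S x) (G x) = ∫ x in Ω, inner ℝ (stressForce S x) (v x) := by
  have hinner : ∀ x, inner ℝ (stressForce S x) (v x)
      = contract (Matrix.of fun i j => -partialDeriv j (fun y => S y i j) x)
          (Matrix.of fun i _ => v x i) := by
    intro x
    simp only [PiLp.inner_apply, stressForce, contract, Matrix.of_apply, RCLike.inner_apply,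
      conj_trivial, neg_mul, Finset.sum_neg_distrib, mul_comm (v x _), Finset.sum_mul]
  simp only [hinner]
  rw [integral_contract (fun i j => (hS i j).memLp Ω 2) hG.1,
    integral_contract (A := fun x => Matrix.of fun i j => -partialDeriv j (fun y => S y i j) x)
      (B := fun x => Matrix.of fun i _ => v x i)
      (fun i j => (((hS i j).pderiv j).memLp Ω 2).neg) (fun i _ => hv.eval_piLp i)]
  refine Finset.sum_congr rfl fun i _ => Finset.sum_congr rfl fun j _ => ?_
  simp only [Matrix.of_apply, mul_comm (S _ i j), mul_comm _ (v _ i), mul_neg, integral_neg,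
    hG.2 _ (hS i j) i j, neg_neg]

lemma symPart_symPart (A : Tensor d) : symPart (symPart A) = symPart A := by
  ext i j
  simp only [symPart_apply]
  ring

lemma symPart_stress_strainRate (μ : ℝ → ℝ) (u : Vec d → Vec d) (x : Vec d) :
    symPart (stress μ (strainRate Ω u x)) = stress μ (strainRate Ω u x) := by
  rw [stress, map_smul, strainRate_eq_symPart, symPart_symPart]

lemma isStokesSolution_of_stress {μ : Vec d → ℝ → ℝ} {u : L2 Ω} (hu : u ∈ Admissible Ω)
    {S : Vec d → Tensor d} (hS : ∀ i j, IsTest Ω fun x => S x i j)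
    (hstress : ∀ᵐ x ∂volume.restrict Ω, stress (μ x) (strainRate Ω u x) = S x) :
    IsStokesSolution Ω μ (stressForce S) u 0 := by
  refine ⟨hu, MemLp.zero, fun v hv => ?_⟩
  obtain ⟨G, hG, -⟩ := hv
  have hgrad := hG.isWeakGradient_weakGradient
  have hintegrand : (fun x => contract (S x) (weakGradient Ω v x)) =ᵐ[volume.restrict Ω]
      viscousIntegrand Ω μ u v := by
    filter_upwards [hstress] with x hx
    rw [viscousIntegrand_eq_contract_stress, strainRate_eq_symPart Ω v, contract_symPart_right,
      symPart_stress_strainRate, hx]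
  refine ⟨(integrable_contract (fun i j => (hS i j).memLp Ω 2) hgrad.1).congr hintegrand, ?_⟩
  rw [← integral_congr_ae hintegrand,
    integral_contract_eq_integral_inner_stressForce hS (Lp.memLp v) hgrad]
  simp only [Pi.zero_apply, zero_mul, integral_zero, sub_zero]

end SmoothSolutions

/-! ### Angular velocity profiles -/

section Profiles

/-- A plateau function, equal to one on `[3/8, 5/8]` and supported in `[1/4, 3/4]`. -/
def wideBump : ContDiffBump (1 / 2 : ℝ) := ⟨1 / 8, 1 / 4, by norm_num, by norm_num⟩

/-- A bump function supported in the plateau of `wideBump`. -/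
def narrowBump : ContDiffBump (1 / 2 : ℝ) := ⟨1 / 16, 1 / 8, by norm_num, by norm_num⟩

/-- A shear rate that differs from `wideBump` only on the plateau of the latter. -/
def raisedBump (t : ℝ) : ℝ := wideBump t + narrowBump t

/-- Smooth nonnegative shear rates supported in `[1/4, 3/4]`. -/
structure IsShearRate (c : ℝ → ℝ) : Prop where
  contDiff : ContDiff ℝ ∞ c
  nonneg : ∀ t, 0 ≤ c t
  eq_zero : ∀ t, 1 / 4 ≤ |t - 1 / 2| → c t = 0

/-- The derivative with respect to `t` of the angular velocity of a vortex with shear rate `c`;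
the denominator is the second invariant of `vortexStrain`, see `tensorInv_vortexStrain`. -/
def shear (c : ℝ → ℝ) (t : ℝ) : ℝ := c t / (t * Real.sqrt (1 - t))

/-- The angular velocity of a vortex with shear rate `c`. -/
def angularVelocity (c : ℝ → ℝ) (t : ℝ) : ℝ := ∫ s in (0 : ℝ)..t, shear c s

lemma isShearRate_wideBump : IsShearRate wideBump :=
  ⟨wideBump.contDiff, fun _ => wideBump.nonneg, fun _ h => wideBump.zero_of_le_dist h⟩

lemma isShearRate_raisedBump : IsShearRate raisedBump where
  contDiff := wideBump.contDiff.add narrowBump.contDiff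
  nonneg _ := add_nonneg wideBump.nonneg narrowBump.nonneg
  eq_zero t ht := by
    rw [raisedBump, wideBump.zero_of_le_dist ht, narrowBump.zero_of_le_dist, add_zero]
    exact le_trans (by norm_num [narrowBump]) ht

lemma min_one_wideBump (t : ℝ) : min 1 (wideBump t) = wideBump t :=
  min_eq_right wideBump.le_one

lemma min_one_raisedBump (t : ℝ) : min 1 (raisedBump t) = wideBump t := by
  rw [raisedBump]
  by_cases ht : t ∈ Metric.closedBall (1 / 2 : ℝ) (1 / 8)
  · rw [wideBump.one_of_mem_closedBall ht, min_eq_left]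
    linarith [narrowBump.nonneg (x := t)]
  · have hnarrow : narrowBump t = 0 := narrowBump.zero_of_le_dist (by
      rw [Metric.mem_closedBall, not_le] at ht
      exact ht.le)
    rw [hnarrow, add_zero, min_one_wideBump]

variable {c : ℝ → ℝ}

lemma IsShearRate.contDiff_shear (hc : IsShearRate c) : ContDiff ℝ ∞ (shear c) := by
  rw [contDiff_iff_contDiffAt]
  intro t
  by_cases ht : |t - 1 / 2| < 1 / 2
  · obtain ⟨hlow, hupp⟩ := abs_lt.1 ht
    have hupp' : 0 < 1 - t := by linarith
    have hlow' : 0 < t := by linarith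
    exact hc.contDiff.contDiffAt.div (contDiffAt_id.mul
      ((contDiffAt_const.sub contDiffAt_id).sqrt hupp'.ne')) (by positivity)
  · have houtside : ∀ᶠ s in 𝓝 t, 1 / 4 < |s - 1 / 2| :=
      ((by fun_prop : Continuous fun s : ℝ => |s - 1 / 2|).tendsto t).eventually_const_lt
        (by linarith [not_lt.1 ht])
    refine (contDiffAt_const (c := (0 : ℝ))).congr_of_eventuallyEq ?_
    filter_upwards [houtside] with s hs
    rw [shear, hc.eq_zero s hs.le, zero_div]

lemma IsShearRate.hasDerivAt (hc : IsShearRate c) (t : ℝ) :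
    HasDerivAt (angularVelocity c) (shear c t) t :=
  hc.contDiff_shear.continuous.integral_hasStrictDerivAt 0 t |>.hasDerivAt

lemma IsShearRate.contDiff_angularVelocity (hc : IsShearRate c) :
    ContDiff ℝ ∞ (angularVelocity c) := by
  rw [contDiff_infty_iff_deriv]
  refine ⟨fun t => (hc.hasDerivAt t).differentiableAt, ?_⟩
  rw [show deriv (angularVelocity c) = shear c from funext fun t => (hc.hasDerivAt t).deriv]
  exact hc.contDiff_shear

lemma IsShearRate.angularVelocity_eq_zero (hc : IsShearRate c) {t : ℝ} (h0 : 0 ≤ t)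
    (ht : t ≤ 1 / 4) : angularVelocity c t = 0 := by
  have hshear : Set.EqOn (shear c) (fun _ => 0) (Set.uIcc 0 t) := by
    intro s hs
    rw [Set.uIcc_of_le h0] at hs
    have hfar : 1 / 4 ≤ |s - 1 / 2| := by
      rw [abs_sub_comm]
      exact le_trans (by linarith [hs.2]) (le_abs_self _)
    rw [shear, hc.eq_zero s hfar, zero_div]
  rw [angularVelocity, intervalIntegral.integral_congr hshear, intervalIntegral.integral_zero]

lemma IsShearRate.abs_shear_mul (hc : IsShearRate c) (t : ℝ) :
    |shear c t| * (t * Real.sqrt (1 - t)) = c t := by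
  by_cases ht : |t - 1 / 2| < 1 / 2
  · obtain ⟨hlow, hupp⟩ := abs_lt.1 ht
    have hsqrt : 0 < Real.sqrt (1 - t) := Real.sqrt_pos.2 (by linarith)
    have hlow' : 0 < t := by linarith
    have hshear : 0 ≤ shear c t := div_nonneg (hc.nonneg t) (by positivity)
    rw [abs_of_nonneg hshear, shear, div_mul_cancel₀ _ (by positivity)]
  · have hzero : c t = 0 := hc.eq_zero t (by linarith [not_lt.1 ht])
    rw [shear, hzero, zero_div, abs_zero, zero_mul]

lemma shear_raisedBump (t : ℝ) : shear raisedBump t = shear wideBump t + shear narrowBump t :=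
  add_div _ _ _

lemma angularVelocity_wideBump_lt_raisedBump :
    angularVelocity wideBump 1 < angularVelocity raisedBump 1 := by
  refine intervalIntegral.integral_lt_integral_of_continuousOn_of_le_of_exists_lt zero_lt_one
    isShearRate_wideBump.contDiff_shear.continuous.continuousOn
    isShearRate_raisedBump.contDiff_shear.continuous.continuousOn
    (fun t ht => ?_) ⟨1 / 2, by norm_num, ?_⟩
  · rw [shear_raisedBump, le_add_iff_nonneg_right]
    exact div_nonneg narrowBump.nonneg (mul_nonneg ht.1.le (Real.sqrt_nonneg _))
  · rw [shear_raisedBump, lt_add_iff_pos_right]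
    have hcenter : narrowBump (1 / 2) = 1 :=
      narrowBump.one_of_mem_closedBall (Metric.mem_closedBall_self narrowBump.rIn_pos.le)
    rw [shear, hcenter]
    exact div_pos one_pos (mul_pos one_half_pos (Real.sqrt_pos.2 (by norm_num)))

end Profiles

/-! ### Toroidal vortices -/

section RotationAndTorus

variable {d : ℕ} (i₀ i₁ : Fin d)

/-- The infinitesimal rotation in the plane of the coordinates `i₀` and `i₁`. -/
def rot : Vec d →L[ℝ] Vec d :=
  (EuclideanSpace.proj i₀).smulRight (EuclideanSpace.single i₁ (1 : ℝ))
    - (EuclideanSpace.proj i₁).smulRight (EuclideanSpace.single i₀ (1 : ℝ))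

/-- The projection to the plane of the rotation `rot i₀ i₁`. -/
def planeProj (x : Vec d) : Vec d :=
  x i₀ • EuclideanSpace.single i₀ (1 : ℝ) + x i₁ • EuclideanSpace.single i₁ (1 : ℝ)

/-- The squared distance from the axis of the rotation `rot i₀ i₁`. -/
def axisDistSq (x : Vec d) : ℝ := x i₀ ^ 2 + x i₁ ^ 2

/-- A function whose level sets are nested tori around the unit circle of the rotation; it is
`cosh⁻²` of the hyperbolic distance from that circle in the meridian half-plane. -/
def torus (x : Vec d) : ℝ := 4 * axisDistSq i₀ i₁ x * ((‖x‖ ^ 2 + 1) ^ 2)⁻¹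

/-- The gradient of `torus`. -/
def torusGrad (x : Vec d) : Vec d :=
  (8 / (‖x‖ ^ 2 + 1) ^ 2) • planeProj i₀ i₁ x
    - (16 * axisDistSq i₀ i₁ x / (‖x‖ ^ 2 + 1) ^ 3) • x

lemma rot_eq (x : Vec d) : rot i₀ i₁ x
    = x i₀ • EuclideanSpace.single i₁ (1 : ℝ) - x i₁ • EuclideanSpace.single i₀ (1 : ℝ) := rfl

lemma inner_rot (x y : Vec d) : inner ℝ (rot i₀ i₁ x) y = x i₀ * y i₁ - x i₁ * y i₀ := by
  simp [rot_eq, inner_sub_left, inner_smul_left, EuclideanSpace.inner_single_left]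

lemma inner_planeProj (x y : Vec d) :
    inner ℝ (planeProj i₀ i₁ x) y = x i₀ * y i₀ + x i₁ * y i₁ := by
  simp [planeProj, inner_add_left, inner_smul_left, EuclideanSpace.inner_single_left]

lemma inner_rot_self (x : Vec d) : inner ℝ (rot i₀ i₁ x) x = 0 := by
  rw [inner_rot]
  ring

lemma inner_planeProj_self (x : Vec d) : inner ℝ (planeProj i₀ i₁ x) x = axisDistSq i₀ i₁ x := by
  rw [inner_planeProj, axisDistSq]
  ring

lemma rot_single_apply_swap (i j : Fin d) :
    rot i₀ i₁ (EuclideanSpace.single j 1) i = -rot i₀ i₁ (EuclideanSpace.single i 1) j := by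
  have hentry : ∀ i j, rot i₀ i₁ (EuclideanSpace.single j 1) i
      = inner ℝ (rot i₀ i₁ (EuclideanSpace.single j 1)) (EuclideanSpace.single i (1 : ℝ)) := by
    intro i j
    simp [EuclideanSpace.inner_single_right]
  rw [hentry, hentry, inner_rot, inner_rot]
  ring

lemma axisDistSq_nonneg (x : Vec d) : 0 ≤ axisDistSq i₀ i₁ x := by
  unfold axisDistSq
  positivity

lemma torus_nonneg (x : Vec d) : 0 ≤ torus i₀ i₁ x := by
  have := axisDistSq_nonneg i₀ i₁ x
  unfold torus
  positivity

variable {i₀ i₁}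

lemma norm_rot_sq (h : i₀ ≠ i₁) (x : Vec d) : ‖rot i₀ i₁ x‖ ^ 2 = axisDistSq i₀ i₁ x := by
  rw [← real_inner_self_eq_norm_sq, inner_rot, rot_eq, axisDistSq]
  simp [h, h.symm, sq]

lemma norm_planeProj_sq (h : i₀ ≠ i₁) (x : Vec d) :
    ‖planeProj i₀ i₁ x‖ ^ 2 = axisDistSq i₀ i₁ x := by
  rw [← real_inner_self_eq_norm_sq, inner_planeProj, planeProj, axisDistSq]
  simp [h, h.symm, sq]

lemma inner_rot_planeProj (h : i₀ ≠ i₁) (x : Vec d) :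
    inner ℝ (rot i₀ i₁ x) (planeProj i₀ i₁ x) = 0 := by
  rw [inner_rot, planeProj]
  simp [h, h.symm, mul_comm]

lemma inner_rot_torusGrad (h : i₀ ≠ i₁) (x : Vec d) :
    inner ℝ (rot i₀ i₁ x) (torusGrad i₀ i₁ x) = 0 := by
  rw [torusGrad, inner_sub_right, inner_smul_right, inner_smul_right, inner_rot_planeProj h,
    inner_rot_self, mul_zero, mul_zero, sub_zero]

lemma norm_torusGrad_sq (h : i₀ ≠ i₁) (x : Vec d) :
    axisDistSq i₀ i₁ x * ‖torusGrad i₀ i₁ x‖ ^ 2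
      = 4 * torus i₀ i₁ x ^ 2 * (1 - torus i₀ i₁ x) := by
  rw [torusGrad, norm_sub_sq_real, norm_smul, norm_smul, mul_pow, mul_pow, norm_planeProj_sq h,
    inner_smul_left, inner_smul_right, inner_planeProj_self, torus]
  simp only [Real.norm_eq_abs, sq_abs, conj_trivial]
  field_simp
  ring

lemma axisDistSq_le_norm_sq (h : i₀ ≠ i₁) (x : Vec d) : axisDistSq i₀ i₁ x ≤ ‖x‖ ^ 2 := by
  rw [EuclideanSpace.real_norm_sq_eq, axisDistSq, ← Finset.sum_pair (f := fun i => x i ^ 2) h]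
  exact Finset.sum_le_sum_of_subset_of_nonneg (Finset.subset_univ _) fun _ _ _ => sq_nonneg _

lemma norm_le_of_le_torus (h : i₀ ≠ i₁) {x : Vec d} (hx : 1 / 4 ≤ torus i₀ i₁ x) : ‖x‖ ≤ 4 := by
  rw [torus, le_mul_inv_iff₀ (by positivity)] at hx
  have hquad : (‖x‖ ^ 2 + 1) ^ 2 ≤ 16 * ‖x‖ ^ 2 := by linarith [axisDistSq_le_norm_sq h x]
  refine abs_le_of_sq_le_sq' ?_ (by norm_num) |>.2
  nlinarith [sq_nonneg ‖x‖]

lemma contDiff_axisDistSq : ContDiff ℝ ∞ (axisDistSq i₀ i₁) :=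
  ((contDiff_coord _).pow 2).add ((contDiff_coord _).pow 2)

lemma contDiff_torus : ContDiff ℝ ∞ (torus i₀ i₁) :=
  (contDiff_const.mul contDiff_axisDistSq).mul
    ((((contDiff_norm_sq ℝ).add contDiff_const).pow 2).inv fun x => by positivity)

lemma partialDeriv_axisDistSq (j : Fin d) (x : Vec d) :
    partialDeriv j (axisDistSq i₀ i₁) x = 2 * planeProj i₀ i₁ x j := by
  have hcoord : ∀ i : Fin d, DifferentiableAt ℝ (fun y : Vec d => y i) x :=
    fun i => (contDiff_coord i).differentiable (by simp) x
  have hsq : ∀ i : Fin d, partialDeriv j (fun y : Vec d => y i ^ 2) x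
      = 2 * x i * if i = j then 1 else 0 := by
    intro i
    rw [partialDeriv_comp (H := fun t => t ^ 2) (H' := 2 * x i)
      (by simpa using hasDerivAt_pow 2 (x i)) (hcoord i), partialDeriv_coord_id]
  unfold axisDistSq
  rw [partialDeriv_add ((hcoord i₀).fun_pow 2) ((hcoord i₁).fun_pow 2), hsq, hsq]
  simp only [planeProj, PiLp.add_apply, PiLp.smul_apply, PiLp.single_apply, smul_eq_mul,
    eq_comm (a := j)]
  ring

lemma hasDerivAt_inv_add_one_sq {q : ℝ} (hq : q + 1 ≠ 0) :
    HasDerivAt (fun q : ℝ => ((q + 1) ^ 2)⁻¹) (-2 / (q + 1) ^ 3) q := by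
  refine ((((hasDerivAt_id' q).add_const 1).fun_pow 2).fun_inv (pow_ne_zero 2 hq)).congr_deriv ?_
  field_simp
  norm_num
  ring

lemma partialDeriv_torus (j : Fin d) (x : Vec d) :
    partialDeriv j (torus i₀ i₁) x = torusGrad i₀ i₁ x j := by
  have hnorm : DifferentiableAt ℝ (fun y : Vec d => ‖y‖ ^ 2) x :=
    (contDiff_norm_sq ℝ).differentiable (n := ∞) (by simp) x
  have hderiv := hasDerivAt_inv_add_one_sq (q := ‖x‖ ^ 2) (by positivity)
  have hinv : DifferentiableAt ℝ (fun y : Vec d => ((‖y‖ ^ 2 + 1) ^ 2)⁻¹) x :=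
    DifferentiableAt.comp (g := fun q : ℝ => ((q + 1) ^ 2)⁻¹) x hderiv.differentiableAt hnorm
  have haxis : DifferentiableAt ℝ (axisDistSq i₀ i₁) x :=
    contDiff_axisDistSq.differentiable (by simp) x
  have hscaled : partialDeriv j (fun y => 4 * axisDistSq i₀ i₁ y) x
      = 4 * partialDeriv j (axisDistSq i₀ i₁) x := partialDeriv_const_smul haxis 4 j
  unfold torus
  rw [partialDeriv_mul (haxis.const_mul 4) hinv, hscaled, partialDeriv_axisDistSq,
    partialDeriv_comp hderiv hnorm, partialDeriv_norm_sq, torusGrad]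
  simp only [PiLp.sub_apply, PiLp.smul_apply, smul_eq_mul]
  field_simp
  ring

end RotationAndTorus

section Vortex

variable {d : ℕ} (i₀ i₁ : Fin d)

/-- The velocity field rotating with angular velocity `H` on the level sets of `torus`. -/
def vortex (H : ℝ → ℝ) (x : Vec d) : Vec d := H (torus i₀ i₁ x) • rot i₀ i₁ x

/-- The strain rate of `vortex` per unit of the derivative of its angular velocity. -/
def vortexStrain (x : Vec d) : Tensor d :=
  symPart (Matrix.vecMulVec (rot i₀ i₁ x) (torusGrad i₀ i₁ x))

/-- The common stress field of the vortices with shear rates `wideBump` and `raisedBump`, for the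
ideal law with reference viscosity `1`, yield stress `2` and no lower bound. -/
def vortexStress (x : Vec d) : Tensor d :=
  (2 : ℝ) • symPart (classicalGradient (vortex i₀ i₁ (angularVelocity wideBump)) x)

variable {i₀ i₁} {H H' c : ℝ → ℝ}

lemma classicalGradient_vortex (hH : ∀ t, HasDerivAt H (H' t) t) (x : Vec d) (i j : Fin d) :
    classicalGradient (vortex i₀ i₁ H) x i j
      = H' (torus i₀ i₁ x) * (rot i₀ i₁ x i * torusGrad i₀ i₁ x j)
        + H (torus i₀ i₁ x) * rot i₀ i₁ (EuclideanSpace.single j 1) i := by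
  have htorus : DifferentiableAt ℝ (torus i₀ i₁) x := contDiff_torus.differentiable (by simp) x
  have hangular : DifferentiableAt ℝ (fun y => H (torus i₀ i₁ y)) x :=
    (hH _).differentiableAt.comp x htorus
  have hrot : partialDeriv j (rot i₀ i₁) x = rot i₀ i₁ (EuclideanSpace.single j 1) := by
    rw [partialDeriv, ContinuousLinearMap.fderiv]
  unfold vortex
  rw [classicalGradient_apply, partialDeriv_smul hangular (rot i₀ i₁).differentiableAt,
    partialDeriv_comp (hH _) htorus, partialDeriv_torus, hrot]
  simp only [PiLp.add_apply, PiLp.smul_apply, smul_eq_mul]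
  ring

lemma symPart_classicalGradient_vortex (hH : ∀ t, HasDerivAt H (H' t) t) (x : Vec d) :
    symPart (classicalGradient (vortex i₀ i₁ H) x)
      = H' (torus i₀ i₁ x) • vortexStrain i₀ i₁ x := by
  ext i j
  rw [symPart_apply, classicalGradient_vortex hH, classicalGradient_vortex hH,
    rot_single_apply_swap i₀ i₁ i j, Matrix.smul_apply, vortexStrain, symPart_apply,
    Matrix.vecMulVec_apply, Matrix.vecMulVec_apply, smul_eq_mul]
  ring

lemma trace_classicalGradient_vortex (h : i₀ ≠ i₁) (hH : ∀ t, HasDerivAt H (H' t) t) (x : Vec d) :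
    (classicalGradient (vortex i₀ i₁ H) x).trace = 0 := by
  have hdiag : ∀ i, classicalGradient (vortex i₀ i₁ H) x i i
      = H' (torus i₀ i₁ x) * (rot i₀ i₁ x i * torusGrad i₀ i₁ x i) := by
    intro i
    rw [classicalGradient_vortex hH, self_eq_neg.1 (rot_single_apply_swap i₀ i₁ i i), mul_zero,
      add_zero]
  have horth : ∑ i, rot i₀ i₁ x i * torusGrad i₀ i₁ x i = 0 := by
    simpa [PiLp.inner_apply, mul_comm] using inner_rot_torusGrad h x
  simp only [Matrix.trace, Matrix.diag_apply, hdiag]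
  rw [← Finset.mul_sum, horth, mul_zero]

lemma contract_symPart_vecMulVec (a b : Vec d) :
    contract (symPart (Matrix.vecMulVec a b)) (symPart (Matrix.vecMulVec a b))
      = 1 / 2 * (‖a‖ ^ 2 * ‖b‖ ^ 2 + inner ℝ a b ^ 2) := by
  have hterm : ∀ i j, 1 / 2 * (a i * b j + a j * b i) * (a i * b j)
      = 1 / 2 * (a i ^ 2 * b j ^ 2) + 1 / 2 * ((b i * a i) * (b j * a j)) :=
    fun i j => by ring
  rw [contract_symPart_right, symPart_symPart, EuclideanSpace.real_norm_sq_eq,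
    EuclideanSpace.real_norm_sq_eq, sq (inner ℝ a b), PiLp.inner_apply]
  simp only [contract, symPart_apply, Matrix.vecMulVec_apply, hterm, Finset.sum_add_distrib,
    ← Finset.mul_sum, ← Finset.sum_mul, RCLike.inner_apply, conj_trivial]
  ring

lemma tensorInv_vortexStrain (h : i₀ ≠ i₁) (x : Vec d) :
    tensorInv (vortexStrain i₀ i₁ x) = torus i₀ i₁ x * √(1 - torus i₀ i₁ x) := by
  have hinv : 1 / 2 * contract (vortexStrain i₀ i₁ x) (vortexStrain i₀ i₁ x)
      = torus i₀ i₁ x ^ 2 * (1 - torus i₀ i₁ x) := by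
    rw [vortexStrain, contract_symPart_vecMulVec, norm_rot_sq h, norm_torusGrad_sq h,
      inner_rot_torusGrad h]
    ring
  rw [tensorInv, hinv, Real.sqrt_mul (sq_nonneg _), Real.sqrt_sq (torus_nonneg i₀ i₁ x)]

lemma isTest_vortex (h : i₀ ≠ i₁) (hc : IsShearRate c) :
    IsTest (Metric.ball (0 : Vec d) 5) (vortex i₀ i₁ (angularVelocity c)) := by
  have hsupport : Function.support (vortex i₀ i₁ (angularVelocity c))
      ⊆ Metric.closedBall (0 : Vec d) 4 := by
    intro x hx
    rw [mem_closedBall_zero_iff]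
    refine norm_le_of_le_torus h (le_of_not_gt fun ht => hx ?_)
    rw [vortex, hc.angularVelocity_eq_zero (torus_nonneg i₀ i₁ x) ht.le, zero_smul]
  exact ⟨(hc.contDiff_angularVelocity.comp contDiff_torus).smul (rot i₀ i₁).contDiff,
    HasCompactSupport.of_support_subset_isCompact (isCompact_closedBall _ _) hsupport,
    (closure_minimal hsupport Metric.isClosed_closedBall).trans
      (Metric.closedBall_subset_ball (by norm_num))⟩

lemma isTest_vortexStress (h : i₀ ≠ i₁) (i j : Fin d) :
    IsTest (Metric.ball (0 : Vec d) 5) fun x => vortexStress i₀ i₁ x i j := by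
  have htest := isTest_vortex h isShearRate_wideBump
  simp only [vortexStress, Matrix.smul_apply, symPart_apply]
  have hsum := (htest.gradient_entry i j).add (htest.gradient_entry j i)
  exact (hsum.const_smul (1 / 2)).const_smul 2

/-- In the plastic range the stress of the ideal law does not depend on the size of the strain
rate, so that it only sees the truncation of the shear rate `c`. -/
lemma stress_viscIdeal_smul_vortexStrain (h : i₀ ≠ i₁) (hc : IsShearRate c)
    (hplastic : ∀ t, min 1 (c t) = wideBump t) (x : Vec d) :
    stress (viscIdeal 0 1 2) (shear c (torus i₀ i₁ x) • vortexStrain i₀ i₁ x)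
      = vortexStress i₀ i₁ x := by
  set t := torus i₀ i₁ x
  have hmin : viscIdeal 0 1 2 (c t) * c t = wideBump t := by
    have := two_mul_viscIdeal_zero_mul one_pos two_pos (hc.nonneg t)
    rw [← hplastic, ← mul_right_inj' two_ne_zero, ← mul_assoc, this,
      mul_min_of_nonneg _ _ zero_le_two, mul_one]
  rw [stress, tensorInv_smul, tensorInv_vortexStrain h, hc.abs_shear_mul, vortexStress,
    symPart_classicalGradient_vortex isShearRate_wideBump.hasDerivAt, smul_smul, smul_smul]
  congr 1
  rw [shear, shear, ← hmin]
  ring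

/-- The velocity field of the vortex with shear rate `c`, as an element of `L²`. -/
def vortexField (h : i₀ ≠ i₁) (hc : IsShearRate c) : L2 (Metric.ball (0 : Vec d) 5) :=
  ((isTest_vortex h hc).memLp _ 2).toLp

lemma isStokesSolution_vortexField (h : i₀ ≠ i₁) (hc : IsShearRate c)
    (hplastic : ∀ t, min 1 (c t) = wideBump t) :
    IsStokesSolution (Metric.ball (0 : Vec d) 5) (fun _ s => viscIdeal 0 1 2 s)
      (stressForce (vortexStress i₀ i₁)) (vortexField h hc) 0 := by
  have htest := isTest_vortex h hc
  refine isStokesSolution_of_stress (htest.mem_admissible Metric.isOpen_ball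
    (trace_classicalGradient_vortex h hc.hasDerivAt)) (isTest_vortexStress h) ?_
  filter_upwards [htest.weakGradient_ae_eq Metric.isOpen_ball] with x hgradient
  rw [← stress_viscIdeal_smul_vortexStrain h hc hplastic,
    ← symPart_classicalGradient_vortex hc.hasDerivAt, ← hgradient]
  rfl

lemma torus_single (h : i₀ ≠ i₁) : torus i₀ i₁ (EuclideanSpace.single i₀ 1) = 1 := by
  norm_num [torus, axisDistSq, h.symm]

lemma vortex_single (h : i₀ ≠ i₁) : vortex i₀ i₁ H (EuclideanSpace.single i₀ 1) i₁ = H 1 := by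
  simp [vortex, torus_single h, rot_eq, h.symm]

lemma vortexField_ne (h : i₀ ≠ i₁) :
    vortexField h isShearRate_wideBump ≠ vortexField h isShearRate_raisedBump := by
  intro heq
  have hwide := isTest_vortex h isShearRate_wideBump
  have hraised := isTest_vortex h isShearRate_raisedBump
  have hae := (MemLp.toLp_eq_toLp_iff (hwide.memLp _ 2) (hraised.memLp _ 2)).1 heq
  have hon := Measure.eqOn_open_of_ae_eq hae Metric.isOpen_ball hwide.1.continuous.continuousOn
    hraised.1.continuous.continuousOn
  have hvalue := congrArg (fun v : Vec d => v i₁)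
    (hon (x := EuclideanSpace.single i₀ 1) (by simp))
  simp only [vortex_single h] at hvalue
  exact angularVelocity_wideBump_lt_raisedBump.ne hvalue

lemma exists_isStokesSolution_ideal_ne (hd : 2 ≤ d) :
    ∃ (Ω : Set (Vec d)) (μr τy : ℝ) (f : Vec d → Vec d),
      IsOpen Ω ∧ IsConnected Ω ∧ Bornology.IsBounded Ω ∧ 0 < μr ∧ 0 < τy ∧
      MemLp f 2 (volume.restrict Ω) ∧
      ∃ (u₁ u₂ : L2 Ω) (p₁ p₂ : Vec d → ℝ),
        IsStokesSolution Ω (fun _ s => viscIdeal 0 μr τy s) f u₁ p₁ ∧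
        IsStokesSolution Ω (fun _ s => viscIdeal 0 μr τy s) f u₂ p₂ ∧
        IsVelocitySolution Ω (fun _ s => viscIdeal 0 μr τy s) f u₁ ∧
        IsVelocitySolution Ω (fun _ s => viscIdeal 0 μr τy s) f u₂ ∧
        u₁ ≠ u₂ := by
  have h : (⟨0, by omega⟩ : Fin d) ≠ ⟨1, hd⟩ := by simp
  have hwide := isStokesSolution_vortexField h isShearRate_wideBump min_one_wideBump
  have hraised := isStokesSolution_vortexField h isShearRate_raisedBump min_one_raisedBump
  exact ⟨Metric.ball 0 5, 1, 2, stressForce (vortexStress _ _), Metric.isOpen_ball,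
    (convex_ball _ _).isConnected (Metric.nonempty_ball.2 (by norm_num)), Metric.isBounded_ball,
    one_pos, two_pos, memLp_stressForce (isTest_vortexStress h), _, _, 0, 0, hwide, hraised,
    hwide.isVelocitySolution, hraised.isVelocitySolution, vortexField_ne h⟩

end Vortex

end Viscoplastic

end

open Viscoplastic in
theorem mainTheorem2_general (d : ℕ) (hd : 2 ≤ d) :
    (∀ (Ω : Set (Vec d)), IsOpen Ω → Bornology.IsBounded Ω →
      ∀ (μr τy : Vec d → ℝ) (f : Vec d → Vec d),
        AEMeasurable μr (volume.restrict Ω) →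
        MemLp τy 2 (volume.restrict Ω) →
        MemLp f 2 (volume.restrict Ω) →
        (∀ᵐ x ∂(volume.restrict Ω), 0 < μr x ∧ 0 < τy x) →
        (∀ μlow : ℝ, 0 ≤ μlow →
          (IntegrableOn (fun x => phiIdeal (μr x) (τy x) 0) Ω →
            (∀ u ∈ Admissible Ω, EnergyFinite Ω (fun x s => phiIdeal (μr x) (τy x) s) f u) ∧
            ConvexOn ℝ (Admissible Ω) (energy Ω (fun x s => phiIdeal (μr x) (τy x) s) μlow f) ∧
            (0 < μlow → StrictConvexOn ℝ (Admissible Ω)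
              (energy Ω (fun x s => phiIdeal (μr x) (τy x) s) μlow f))) ∧
          (0 < μlow →
            (∃! u : L2 Ω, IsVelocitySolution Ω (fun x s => viscIdeal μlow (μr x) (τy x) s) f u) ∧
            (∀ (u₁ u₂ : L2 Ω) (p₁ p₂ : Vec d → ℝ),
              IsStokesSolution Ω (fun x s => viscIdeal μlow (μr x) (τy x) s) f u₁ p₁ →
              IsStokesSolution Ω (fun x s => viscIdeal μlow (μr x) (τy x) s) f u₂ p₂ →
              u₁ = u₂))) ∧
        (IntegrableOn (fun x => phiComposite (μr x) (τy x) 0) Ω →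
          (∀ u ∈ Admissible Ω, EnergyFinite Ω (fun x s => phiComposite (μr x) (τy x) s) f u) ∧
          ConvexOn ℝ (Admissible Ω) (energy Ω (fun x s => phiComposite (μr x) (τy x) s) 0 f) ∧
          StrictConvexOn ℝ (Admissible Ω)
            (energy Ω (fun x s => phiComposite (μr x) (τy x) s) 0 f)) ∧
        (∀ u₁ u₂ : L2 Ω,
          IsVelocitySolution Ω (fun x s => viscComposite (μr x) (τy x) s) f u₁ →
          IsVelocitySolution Ω (fun x s => viscComposite (μr x) (τy x) s) f u₂ →
          u₁ = u₂) ∧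
        (∀ (u₁ u₂ : L2 Ω) (p₁ p₂ : Vec d → ℝ),
          IsStokesSolution Ω (fun x s => viscComposite (μr x) (τy x) s) f u₁ p₁ →
          IsStokesSolution Ω (fun x s => viscComposite (μr x) (τy x) s) f u₂ p₂ →
          u₁ = u₂)) ∧
    (∃ (Ω : Set (Vec d)) (μr τy : ℝ) (f : Vec d → Vec d),
      IsOpen Ω ∧ IsConnected Ω ∧ Bornology.IsBounded Ω ∧ 0 < μr ∧ 0 < τy ∧
      MemLp f 2 (volume.restrict Ω) ∧
      ∃ (u₁ u₂ : L2 Ω) (p₁ p₂ : Vec d → ℝ),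
        IsStokesSolution Ω (fun _ s => viscIdeal 0 μr τy s) f u₁ p₁ ∧
        IsStokesSolution Ω (fun _ s => viscIdeal 0 μr τy s) f u₂ p₂ ∧
        IsVelocitySolution Ω (fun _ s => viscIdeal 0 μr τy s) f u₁ ∧
        IsVelocitySolution Ω (fun _ s => viscIdeal 0 μr τy s) f u₂ ∧
        u₁ ≠ u₂) := by
  have hd0 : 0 < d := by omega
  refine ⟨fun Ω hΩ hb μr τy f hμr hτy hf hpos => ?_, exists_isStokesSolution_ideal_ne hd⟩
  have hcomposite := hpos.mono fun x hx => isStrictPotential_phiComposite hx.1 hx.2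
  have hunique : ∀ u₁ u₂ : L2 Ω,
      IsVelocitySolution Ω (fun x s => viscComposite (μr x) (τy x) s) f u₁ →
      IsVelocitySolution Ω (fun x s => viscComposite (μr x) (τy x) s) f u₂ → u₁ = u₂ :=
    fun _ _ h₁ h₂ => h₁.unique hΩ hb hd0 hcomposite h₂
  refine ⟨fun m hm => ⟨fun h0 => ?_, fun hm => ?_⟩, fun h0 => ?_, hunique,
    fun _ _ _ _ h₁ h₂ => hunique _ _ h₁.isVelocitySolution h₂.isVelocitySolution⟩
  · have hfin := fun u (hu : u ∈ Admissible Ω) =>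
      (isYieldLaw_ideal hμr hτy.aemeasurable hpos).energyFinite hτy hf h0 hu.1
    exact ⟨hfin, convexOn_energy hΩ hf hfin
        (hpos.mono fun x hx => isPotential_phiIdeal_add_sq hx.1 hx.2 hm),
      fun hm => strictConvexOn_energy hΩ hb hd0 hf hfin
        (hpos.mono fun x hx => isStrictPotential_phiIdeal_add_sq hx.1 hx.2 hm)⟩
  · have hideal := hpos.mono fun x hx => isStrictPotential_phiIdeal_add_sq hx.1 hx.2 hm
    obtain ⟨u, hu⟩ := exists_isVelocitySolution_ideal hΩ hb hd0 hm hμr hτy hf hpos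
    exact ⟨⟨u, hu, fun v hv => hv.unique hΩ hb hd0 hideal hu⟩, fun _ _ _ _ h₁ h₂ =>
      h₁.isVelocitySolution.unique hΩ hb hd0 hideal h₂.isVelocitySolution⟩
  · have hfin := fun u (hu : u ∈ Admissible Ω) =>
      (isYieldLaw_composite hμr hτy.aemeasurable hpos).energyFinite hτy hf h0 hu.1
    have hstrict := strictConvexOn_energy (m := 0) hΩ hb hd0 hf hfin (by simpa using hcomposite)
    exact ⟨hfin, hstrict.convexOn, hstrict⟩

theorem mainTheorem2 (d : ℕ) (hd : d = 2 ∨ d = 3) :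
    (∀ (Ω : Set (Viscoplastic.Vec d)), IsOpen Ω → Bornology.IsBounded Ω →
      ∀ (μr τy : Viscoplastic.Vec d → ℝ) (f : Viscoplastic.Vec d → Viscoplastic.Vec d),
        AEMeasurable μr (volume.restrict Ω) →
        MemLp τy 2 (volume.restrict Ω) →
        MemLp f 2 (volume.restrict Ω) →
        (∀ᵐ x ∂(volume.restrict Ω), 0 < μr x ∧ 0 < τy x) →
        -- the ideal law, with lower viscosity bound `μlow`
        (∀ μlow : ℝ, 0 ≤ μlow →
          (IntegrableOn (fun x => Viscoplastic.phiIdeal (μr x) (τy x) 0) Ω →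
            (∀ u ∈ Viscoplastic.Admissible Ω, Viscoplastic.EnergyFinite Ω
              (fun x s => Viscoplastic.phiIdeal (μr x) (τy x) s) f u) ∧
            ConvexOn ℝ (Viscoplastic.Admissible Ω) (Viscoplastic.energy Ω
              (fun x s => Viscoplastic.phiIdeal (μr x) (τy x) s) μlow f) ∧
            (0 < μlow → StrictConvexOn ℝ (Viscoplastic.Admissible Ω) (Viscoplastic.energy Ω
              (fun x s => Viscoplastic.phiIdeal (μr x) (τy x) s) μlow f))) ∧
          (0 < μlow →
            (∃! u : Viscoplastic.L2 Ω, Viscoplastic.IsVelocitySolution Ω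
              (fun x s => Viscoplastic.viscIdeal μlow (μr x) (τy x) s) f u) ∧
            (∀ (u₁ u₂ : Viscoplastic.L2 Ω) (p₁ p₂ : Viscoplastic.Vec d → ℝ),
              Viscoplastic.IsStokesSolution Ω
                (fun x s => Viscoplastic.viscIdeal μlow (μr x) (τy x) s) f u₁ p₁ →
              Viscoplastic.IsStokesSolution Ω
                (fun x s => Viscoplastic.viscIdeal μlow (μr x) (τy x) s) f u₂ p₂ →
              u₁ = u₂))) ∧
        -- the composite law
        (IntegrableOn (fun x => Viscoplastic.phiComposite (μr x) (τy x) 0) Ω →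
          (∀ u ∈ Viscoplastic.Admissible Ω, Viscoplastic.EnergyFinite Ω
            (fun x s => Viscoplastic.phiComposite (μr x) (τy x) s) f u) ∧
          ConvexOn ℝ (Viscoplastic.Admissible Ω) (Viscoplastic.energy Ω
            (fun x s => Viscoplastic.phiComposite (μr x) (τy x) s) 0 f) ∧
          StrictConvexOn ℝ (Viscoplastic.Admissible Ω) (Viscoplastic.energy Ω
            (fun x s => Viscoplastic.phiComposite (μr x) (τy x) s) 0 f)) ∧
        (∀ u₁ u₂ : Viscoplastic.L2 Ω,
          Viscoplastic.IsVelocitySolution Ω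
            (fun x s => Viscoplastic.viscComposite (μr x) (τy x) s) f u₁ →
          Viscoplastic.IsVelocitySolution Ω
            (fun x s => Viscoplastic.viscComposite (μr x) (τy x) s) f u₂ →
          u₁ = u₂) ∧
        (∀ (u₁ u₂ : Viscoplastic.L2 Ω) (p₁ p₂ : Viscoplastic.Vec d → ℝ),
          Viscoplastic.IsStokesSolution Ω
            (fun x s => Viscoplastic.viscComposite (μr x) (τy x) s) f u₁ p₁ →
          Viscoplastic.IsStokesSolution Ω
            (fun x s => Viscoplastic.viscComposite (μr x) (τy x) s) f u₂ p₂ →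
          u₁ = u₂)) ∧
    -- failure of uniqueness for the ideal law without lower viscosity bound
    (∃ (Ω : Set (Viscoplastic.Vec d)) (μr τy : ℝ)
        (f : Viscoplastic.Vec d → Viscoplastic.Vec d),
      IsOpen Ω ∧ IsConnected Ω ∧ Bornology.IsBounded Ω ∧ 0 < μr ∧ 0 < τy ∧
      MemLp f 2 (volume.restrict Ω) ∧
      ∃ (u₁ u₂ : Viscoplastic.L2 Ω) (p₁ p₂ : Viscoplastic.Vec d → ℝ),
        Viscoplastic.IsStokesSolution Ω (fun _ s => Viscoplastic.viscIdeal 0 μr τy s) f u₁ p₁ ∧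
        Viscoplastic.IsStokesSolution Ω (fun _ s => Viscoplastic.viscIdeal 0 μr τy s) f u₂ p₂ ∧
        Viscoplastic.IsVelocitySolution Ω (fun _ s => Viscoplastic.viscIdeal 0 μr τy s) f u₁ ∧
        Viscoplastic.IsVelocitySolution Ω (fun _ s => Viscoplastic.viscIdeal 0 μr τy s) f u₂ ∧
        u₁ ≠ u₂) :=
  mainTheorem2_general d (by omega)
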